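/- For $j=1,2$ let $(\alpha_j,\delta_j,\dot\alpha_j,\dot\delta_j)\in\mathbb{R}^4$ and $\mathbf q_j,\dot{\mathbf q}_j\in\mathbb{R}^3$ be given (the data, a point of $\mathbb{R}^{20}$). Put $$\mathbf e^\rho_j=(\cos\delta_j\cos\alpha_j,\cos\delta_j\sin\alpha_j,\sin\delta_j),\quad \mathbf e^\alpha_j=(-\sin\alpha_j,\cos\alpha_j,0),\quad \mathbf e^\delta_j=\frac{\partial\mathbf e^\rho_j}{\partial\delta_j},\quad \mathbf e^\perp_j=\dot\alpha_j\cos\delta_j\,\mathbf e^\alpha_j+\dot\delta_j\,\mathbf e^\delta_j,$$ and, with unknowns $\rho_j,\dot\rho_j,z_j$, $$\mathbf r_j=\mathbf q_j+\rho_j\mathbf e^\rho_j,\qquad \dot{\mathbf r}_j=\dot{\mathbf q}_j+\dot\rho_j\mathbf e^\rho_j+\rho_j\mathbf e^\perp_j,$$ $$\mathbf c_j=\mathbf r_j\times\dot{\mathbf r}_j,\qquad \tilde{\mathcal E}_j=\tfrac12|\dot{\mathbf r}_j|^2-z_j,\qquad \mu\tilde{\mathbf L}_j=(|\dot{\mathbf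 r}_j|^2-z_j)\mathbf r_j-(\dot{\mathbf r}_j\cdot\mathbf r_j)\dot{\mathbf r}_j$$ (these are the angular momentum, the energy, and $\mu$ times the Laplace-Lenz vector of Kepler's problem with parameter $\mu>0$, with $z_j$ written in place of $\mu/|\mathbf r_j|$). Let $$I=\langle \mathbf c_1-\mathbf c_2,\ \mu(\tilde{\mathbf L}_1-\tilde{\mathbf L}_2),\ \tilde{\mathcal E}_1-\tilde{\mathcal E}_2\rangle\subseteq\mathbb{R}[\rho_1,\rho_2,\dot\rho_1,\dot\rho_2,z_1,z_2]$$ be the ideal generated by the seven components. Write $\mathbf D_j=\mathbf q_j\times\mathbf e^\rho_j$, $\mathbf E_j=\mathbf e^\rho_j\times\mathbf e^\perp_j$, $\mathbf F_j=\mathbf q_j\times\mathbf e^\perp_j+\mathbf e^\rho_j\times\dot{\mathbf q}_j$, $\mathbf G_j=\mathbf q_j\times\dot{\mathbf q}_j$, so that $\mathbf c_j=\mathbf D_j\dot\rho_j+\mathbf E_j\rho_j^2+\mathbf F_j\rho_j+\mathbf G_j$, and let $\mathbf J=\mathbf E_2\rho_2^2-\mathbf E_1\rho_1^2+\mathbf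 F_2\rho_2-\mathbf F_1\rho_1+\mathbf G_2-\mathbf G_1$ and $q=\mathbf J\cdot(\mathbf D_1\times\mathbf D_2)\in\mathbb{R}[\rho_1,\rho_2]$. Let $p_j=\boldsymbol\xi\cdot\mathbf e^\rho_j\in\mathbb{R}[\rho_1,\rho_2]$, where $$\boldsymbol\xi=\tfrac12(|\dot{\mathbf r}_2|^2-|\dot{\mathbf r}_1|^2)\,\mathbf r_1\times\mathbf r_2-(\dot{\mathbf r}_1\cdot\mathbf r_1)\,\dot{\mathbf r}_1\times(\mathbf r_1-\mathbf r_2)+(\dot{\mathbf r}_2\cdot\mathbf r_2)\,\dot{\mathbf r}_2\times(\mathbf r_1-\mathbf r_2)$$ and $\dot\rho_1,\dot\rho_2$ are replaced by $$\dot\rho_1=\frac{\mathbf J\cdot\mathbf D_2\times(\mathbf D_1\times\mathbf D_2)}{|\mathbf D_1\times\mathbf D_2|^2},\qquad \dot\rho_2=\frac{\mathbf J\cdot\mathbf D_1\times(\mathbf D_1\times\mathbf D_2)}{|\mathbf D_1\times\mathbf D_2|^2}.$$ Finally let $\mathfrak u_j=\mathrm{res}(p_j,q,\rho_1)\in\mathbb{R}[\rho_2]$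 for $j=1,2$ and $\mathfrak u=\gcd(\mathfrak u_1,\mathfrak u_2)\in\mathbb{R}[\rho_2]$. Then for generic data, that is, for all data in some open dense subset of $\mathbb{R}^{20}$, the polynomial $\mathfrak u$ has degree $9$, belongs to $I$, and has the minimum degree among the nonzero univariate polynomials in $\rho_2$ that belong to $I$. -/

import Mathlib

open scoped Matrix

namespace KeplerLinkage

/-- An attributable `(α, δ, α', δ')`: right ascension, declination and their time derivatives. -/
abbrev Attributable : Type := ℝ × ℝ × ℝ × ℝ

/-- The data of one short arc: the attributable, the position `𝐪` of the observer and
the velocity `𝐪'` of the observer. It carries the product topology of `ℝ ^ 10`. -/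
abbrev ArcData : Type := Attributable × (Fin 3 → ℝ) × (Fin 3 → ℝ)

noncomputable section

/-! ### Unit vectors attached to a direction on the celestial sphere -/

/-- The line of sight. -/
def eRho (α δ : ℝ) : Fin 3 → ℝ :=
  ![Real.cos δ * Real.cos α, Real.cos δ * Real.sin α, Real.sin δ]

/-- `(cos δ)⁻¹ ∂eRho/∂α`, in closed form (see `hasDerivAt_eRho_left`). -/
def eAlpha (α : ℝ) : Fin 3 → ℝ :=
  ![-Real.sin α, Real.cos α, 0]

/-- `∂eRho/∂δ`, in closed form (see `hasDerivAt_eRho_right`). -/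
def eDelta (α δ : ℝ) : Fin 3 → ℝ :=
  ![-(Real.sin δ * Real.cos α), -(Real.sin δ * Real.sin α), Real.cos δ]

theorem hasDerivAt_eRho_left (α δ : ℝ) :
    HasDerivAt (fun a => eRho a δ) (Real.cos δ • eAlpha α) α := by
  rw [hasDerivAt_pi]
  intro i
  fin_cases i
  · simpa [eRho, eAlpha] using (Real.hasDerivAt_cos α).const_mul (Real.cos δ)
  · simpa [eRho, eAlpha] using (Real.hasDerivAt_sin α).const_mul (Real.cos δ)
  · simpa [eRho, eAlpha] using hasDerivAt_const α (Real.sin δ)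

theorem hasDerivAt_eRho_right (α δ : ℝ) :
    HasDerivAt (fun d => eRho α d) (eDelta α δ) δ := by
  rw [hasDerivAt_pi]
  intro i
  fin_cases i
  · simpa [eRho, eDelta] using (Real.hasDerivAt_cos δ).mul_const (Real.cos α)
  · simpa [eRho, eDelta] using (Real.hasDerivAt_cos δ).mul_const (Real.sin α)
  · simpa [eRho, eDelta] using Real.hasDerivAt_sin δ

namespace ArcData

variable (a : ArcData)

def ra : ℝ := a.1.1
def dec : ℝ := a.1.2.1
def raDot : ℝ := a.1.2.2.1
def decDot : ℝ := a.1.2.2.2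

/-- Position of the observer. -/
def q : Fin 3 → ℝ := a.2.1

/-- Velocity of the observer. -/
def qDot : Fin 3 → ℝ := a.2.2

/-- Line of sight of the arc. -/
def e : Fin 3 → ℝ := eRho a.ra a.dec

/-- `α' cos δ e^α + δ' e^δ`. -/
def ePerp : Fin 3 → ℝ :=
  (a.raDot * Real.cos a.dec) • eAlpha a.ra + a.decDot • eDelta a.ra a.dec

/-- Coefficients in `𝐫 × 𝐫' = D ρ' + E ρ² + F ρ + G`. -/
def D : Fin 3 → ℝ := a.q ⨯₃ a.e
def E : Fin 3 → ℝ := a.e ⨯₃ a.ePerp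
def F : Fin 3 → ℝ := a.q ⨯₃ a.ePerp + a.e ⨯₃ a.qDot
def G : Fin 3 → ℝ := a.q ⨯₃ a.qDot

end ArcData

/-! ### Keplerian integrals, with the unknowns taken in an arbitrary commutative `ℝ`-algebra -/

section Algebraic

variable {R : Type*} [CommRing R] [Algebra ℝ R]

/-- A real vector, seen as a vector with constant entries in `R`. -/
def const (R : Type*) [CommRing R] [Algebra ℝ R] (v : Fin 3 → ℝ) : Fin 3 → R :=
  fun i => algebraMap ℝ R (v i)

/-- `𝐫 = 𝐪 + ρ e^ρ`. -/
def pos (a : ArcData) (ρ : R) : Fin 3 → R :=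
  const R a.q + ρ • const R a.e

/-- `𝐫' = 𝐪' + ρ' e^ρ + ρ (α' cos δ e^α + δ' e^δ)`. -/
def vel (a : ArcData) (ρ ρ' : R) : Fin 3 → R :=
  const R a.qDot + ρ' • const R a.e + ρ • const R a.ePerp

/-- Angular momentum `𝐜 = 𝐫 × 𝐫'`. -/
def angMom (a : ArcData) (ρ ρ' : R) : Fin 3 → R :=
  pos a ρ ⨯₃ vel a ρ ρ'

/-- Energy, with `z` in place of `μ / |𝐫|`. -/
def energy (a : ArcData) (ρ ρ' z : R) : R :=
  algebraMap ℝ R (1 / 2) * (vel a ρ ρ' ⬝ᵥ vel a ρ ρ') - z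

/-- `μ` times the Laplace-Lenz vector, with `z` in place of `μ / |𝐫|`. -/
def muLenz (a : ArcData) (ρ ρ' z : R) : Fin 3 → R :=
  (vel a ρ ρ' ⬝ᵥ vel a ρ ρ' - z) • pos a ρ - (vel a ρ ρ' ⬝ᵥ pos a ρ) • vel a ρ ρ'

theorem angMom_eq (a : ArcData) (ρ ρ' : R) :
    angMom a ρ ρ' =
      ρ' • const R a.D + ρ ^ 2 • const R a.E + ρ • const R a.F + const R a.G := by
  ext i
  fin_cases i <;>
    simp [angMom, pos, vel, const, ArcData.D, ArcData.E, ArcData.F, ArcData.G,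
      cross_apply] <;> ring

/-- `𝐉(ρ₁, ρ₂) = E₂ ρ₂² - E₁ ρ₁² + F₂ ρ₂ - F₁ ρ₁ + G₂ - G₁`. -/
def J (a₁ a₂ : ArcData) (ρ₁ ρ₂ : R) : Fin 3 → R :=
  ρ₂ ^ 2 • const R a₂.E - ρ₁ ^ 2 • const R a₁.E + ρ₂ • const R a₂.F - ρ₁ • const R a₁.F
    + const R a₂.G - const R a₁.G

/-- `q = 𝐉 · (D₁ × D₂)`. -/
def qPoly (a₁ a₂ : ArcData) (ρ₁ ρ₂ : R) : R :=
  J a₁ a₂ ρ₁ ρ₂ ⬝ᵥ const R (a₁.D ⨯₃ a₂.D)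

/-- `|D₁ × D₂|²`. -/
def normSqD (a₁ a₂ : ArcData) : ℝ :=
  (a₁.D ⨯₃ a₂.D) ⬝ᵥ (a₁.D ⨯₃ a₂.D)

/-- The radial velocity `ρ₁'` as a quadratic polynomial in `ρ₁, ρ₂`, obtained from
`D₁ ρ₁' - D₂ ρ₂' = 𝐉` by scalar multiplication with `D₂ × (D₁ × D₂)`. -/
def rhoDot₁ (a₁ a₂ : ArcData) (ρ₁ ρ₂ : R) : R :=
  algebraMap ℝ R (normSqD a₁ a₂)⁻¹ * (J a₁ a₂ ρ₁ ρ₂ ⬝ᵥ const R (a₂.D ⨯₃ (a₁.D ⨯₃ a₂.D)))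

/-- The radial velocity `ρ₂'` as a quadratic polynomial in `ρ₁, ρ₂`, obtained from
`D₁ ρ₁' - D₂ ρ₂' = 𝐉` by scalar multiplication with `D₁ × (D₁ × D₂)`. -/
def rhoDot₂ (a₁ a₂ : ArcData) (ρ₁ ρ₂ : R) : R :=
  algebraMap ℝ R (normSqD a₁ a₂)⁻¹ * (J a₁ a₂ ρ₁ ρ₂ ⬝ᵥ const R (a₁.D ⨯₃ (a₁.D ⨯₃ a₂.D)))

/-- The vector `ξ = [μ (L₁ - L₂) - (ℰ₁ 𝐫₁ - ℰ₂ 𝐫₂)] × (𝐫₁ - 𝐫₂)`, in the expanded form in which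
the terms `μ / |𝐫ⱼ|` have been cancelled (see `xi_eq`). -/
def xi (a₁ a₂ : ArcData) (ρ₁ ρ₂ ρ₁' ρ₂' : R) : Fin 3 → R :=
  (algebraMap ℝ R (1 / 2) *
      (vel a₂ ρ₂ ρ₂' ⬝ᵥ vel a₂ ρ₂ ρ₂' - vel a₁ ρ₁ ρ₁' ⬝ᵥ vel a₁ ρ₁ ρ₁')) •
      (pos a₁ ρ₁ ⨯₃ pos a₂ ρ₂)
    - (vel a₁ ρ₁ ρ₁' ⬝ᵥ pos a₁ ρ₁) • (vel a₁ ρ₁ ρ₁' ⨯₃ (pos a₁ ρ₁ - pos a₂ ρ₂))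
    + (vel a₂ ρ₂ ρ₂' ⬝ᵥ pos a₂ ρ₂) • (vel a₂ ρ₂ ρ₂' ⨯₃ (pos a₁ ρ₁ - pos a₂ ρ₂))

theorem xi_eq (a₁ a₂ : ArcData) (ρ₁ ρ₂ ρ₁' ρ₂' z₁ z₂ : R) :
    xi a₁ a₂ ρ₁ ρ₂ ρ₁' ρ₂' =
      (muLenz a₁ ρ₁ ρ₁' z₁ - muLenz a₂ ρ₂ ρ₂' z₂
        - (energy a₁ ρ₁ ρ₁' z₁ • pos a₁ ρ₁ - energy a₂ ρ₂ ρ₂' z₂ • pos a₂ ρ₂)) ⨯₃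
        (pos a₁ ρ₁ - pos a₂ ρ₂) := by
  have h : algebraMap ℝ R (1 / 2) + algebraMap ℝ R (1 / 2) = 1 := by
    rw [← map_add]; norm_num
  unfold xi muLenz energy
  generalize pos a₁ ρ₁ = r₁
  generalize pos a₂ ρ₂ = r₂
  generalize vel a₁ ρ₁ ρ₁' = v₁
  generalize vel a₂ ρ₂ ρ₂' = v₂
  generalize v₁ ⬝ᵥ r₁ = s₁
  generalize v₂ ⬝ᵥ r₂ = s₂
  generalize v₁ ⬝ᵥ v₁ = w₁
  generalize v₂ ⬝ᵥ v₂ = w₂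
  generalize algebraMap ℝ R (1 / 2) = c at h
  ext i
  fin_cases i <;> simp [cross_apply]
  · linear_combination (w₂ - w₁) * (r₁ 1 * r₂ 2 - r₁ 2 * r₂ 1) * h
  · linear_combination (w₂ - w₁) * (r₁ 2 * r₂ 0 - r₁ 0 * r₂ 2) * h
  · linear_combination (w₂ - w₁) * (r₁ 0 * r₂ 1 - r₁ 1 * r₂ 0) * h

end Algebraic

/-! ### The univariate polynomial `𝔲` -/

section Bivariate

open Polynomial

/-- In `ℝ[X][X]` the outer variable is `ρ₁` and the inner one is `ρ₂`. -/
def biRho₁ : ℝ[X][X] := X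
def biRho₂ : ℝ[X][X] := C X

/-- The bivariate polynomial `q(ρ₁, ρ₂)`. -/
def qBi (a₁ a₂ : ArcData) : ℝ[X][X] :=
  qPoly a₁ a₂ biRho₁ biRho₂

/-- The vector `ξ` after elimination of the radial velocities. -/
def xiBi (a₁ a₂ : ArcData) : Fin 3 → ℝ[X][X] :=
  xi a₁ a₂ biRho₁ biRho₂ (rhoDot₁ a₁ a₂ biRho₁ biRho₂) (rhoDot₂ a₁ a₂ biRho₁ biRho₂)

/-- `p₁ = ξ · e^ρ₁`. -/
def p₁ (a₁ a₂ : ArcData) : ℝ[X][X] := xiBi a₁ a₂ ⬝ᵥ const ℝ[X][X] a₁.e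

/-- `p₂ = ξ · e^ρ₂`. -/
def p₂ (a₁ a₂ : ArcData) : ℝ[X][X] := xiBi a₁ a₂ ⬝ᵥ const ℝ[X][X] a₂.e

/-- `𝔲₁ = res(p₁, q, ρ₁)`, a polynomial in `ρ₂`. -/
def u₁ (a₁ a₂ : ArcData) : ℝ[X] := resultant (p₁ a₁ a₂) (qBi a₁ a₂)

/-- `𝔲₂ = res(p₂, q, ρ₁)`, a polynomial in `ρ₂`. -/
def u₂ (a₁ a₂ : ArcData) : ℝ[X] := resultant (p₂ a₁ a₂) (qBi a₁ a₂)

/-- `𝔲 = gcd(𝔲₁, 𝔲₂)` (a greatest common divisor; it is determined up to a nonzero constant). -/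
def u (a₁ a₂ : ArcData) : ℝ[X] := EuclideanDomain.gcd (u₁ a₁ a₂) (u₂ a₁ a₂)

end Bivariate

/-! ### The ideal of the Keplerian integrals -/

/-- The six unknowns `ρ₁, ρ₂, ρ₁', ρ₂', z₁, z₂`. -/
inductive Unknown : Type
  | rho₁ | rho₂ | rhoDot₁ | rhoDot₂ | z₁ | z₂

section TheIdeal

open MvPolynomial Unknown

/-- The vector polynomial `𝐜₁ - 𝐜₂`. -/
def angMomDiff (a₁ a₂ : ArcData) : Fin 3 → MvPolynomial Unknown ℝ :=
  angMom a₁ (X rho₁) (X Unknown.rhoDot₁) - angMom a₂ (X rho₂) (X Unknown.rhoDot₂)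

/-- The vector polynomial `μ (L₁ - L₂)`. -/
def muLenzDiff (a₁ a₂ : ArcData) : Fin 3 → MvPolynomial Unknown ℝ :=
  muLenz a₁ (X rho₁) (X Unknown.rhoDot₁) (X z₁) - muLenz a₂ (X rho₂) (X Unknown.rhoDot₂) (X z₂)

/-- The polynomial `ℰ₁ - ℰ₂`. -/
def energyDiff (a₁ a₂ : ArcData) : MvPolynomial Unknown ℝ :=
  energy a₁ (X rho₁) (X Unknown.rhoDot₁) (X z₁) - energy a₂ (X rho₂) (X Unknown.rhoDot₂) (X z₂)

/-- `I = ⟨𝐜₁ - 𝐜₂, μ (L₁ - L₂), ℰ₁ - ℰ₂⟩`, an ideal of `ℝ[ρ₁, ρ₂, ρ₁', ρ₂', z₁, z₂]`. -/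
def keplerIdeal (a₁ a₂ : ArcData) : Ideal (MvPolynomial Unknown ℝ) :=
  Ideal.span (Set.range (angMomDiff a₁ a₂) ∪ Set.range (muLenzDiff a₁ a₂) ∪ {energyDiff a₁ a₂})

/-- A univariate polynomial, seen as a polynomial in the unknown `ρ₂`. -/
def inRho₂ (p : Polynomial ℝ) : MvPolynomial Unknown ℝ :=
  Polynomial.aeval (X rho₂) p

end TheIdeal

end

end KeplerLinkage

/-! On the conic q = 0 the formulas for ρ₁', ρ₂' solve 𝐜₁ = 𝐜₂. Every term of ξ is then a multiple
of a cross product of vectors orthogonal to the common angular momentum 𝐜, so ξ is parallel to 𝐜 and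
(ξ·e₁)(𝐜₂·e₂) = (ξ·e₂)(𝐜₁·e₁). The factors 𝐜ⱼ·eⱼ are linear polynomials ℓⱼ in ρⱼ alone, so p₁ ℓ₂ ≡
p₂ ℓ₁ modulo q (`qBi_dvd`). Moreover q = -ℓ₂ (𝐫₂·D₁) - ℓ₁ (𝐫₁·D₂). Taking resultants with q gives,
up to units, 𝔲₁ ℓ₂ = 𝔲₂ m with m = 𝐫₂·D₁ (`associated_u₁_mul`). When ℓ₂ and m are coprime, 𝔲₂ = ℓ₂ 𝔲
up to a unit. Since p₂ and q have total degrees at most 5 and 2, 𝔲₂ has degree at most 10;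
generically it is exactly 10, so 𝔲 has degree 9.

Membership: modulo I the vector ξ vanishes, as do q, p₁, p₂, hence 𝔲₁, 𝔲₂ and their gcd.

Minimality: generically ℓ₂ 𝔲 is separable, so 𝔲 has nine distinct complex roots, none a root of ℓ₂.
Each root s lifts to a complex zero of I: the resultant supplies a common zero of q and p₂; then p₁
= 0 because ℓ₂(s) ≠ 0; so ξ = 0, and suitable z₁, z₂ exist (`exists_energy_eq_muLenz_eq`). A
polynomial in ρ₂ lying in I vanishes at all nine roots.

Genericity: the conditions used say that certain functions, analytic after multiplication by powers
of |D₁ × D₂|², do not vanish. By the identity theorem one explicit pair of arcs makes the generic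
set open and dense. -/

namespace KeplerLinkage

/-! ### Vector identities over a commutative ring. -/

section VectorAlgebra

variable {R : Type*} [CommRing R]

/-- Expansion of j in the frame d₁, d₂, n = d₁ × d₂. Up to the scale |n|², the dual frame is d₂ × n,
-(d₁ × n), n, which explains the minus sign. -/
theorem cramer_cross (d₁ d₂ j : Fin 3 → R) :
    ((d₁ ⨯₃ d₂) ⬝ᵥ (d₁ ⨯₃ d₂)) • j =
      (j ⬝ᵥ (d₂ ⨯₃ (d₁ ⨯₃ d₂))) • d₁ - (j ⬝ᵥ (d₁ ⨯₃ (d₁ ⨯₃ d₂))) • d₂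
        + (j ⬝ᵥ (d₁ ⨯₃ d₂)) • (d₁ ⨯₃ d₂) := by
  ext i
  fin_cases i <;> simp [cross_apply, dotProduct, Fin.sum_univ_three] <;> ring

/-- The matrix with rows a, b, d has determinant with inverse w, so its adjugate recovers x from the
three products. -/
theorem eq_zero_of_dotProduct_eq_zero {a b d x : Fin 3 → R} {w : R}
    (hw : w * ((a ⨯₃ b) ⬝ᵥ d) = 1) (ha : x ⬝ᵥ a = 0) (hb : x ⬝ᵥ b = 0) (hd : x ⬝ᵥ d = 0) :
    x = 0 := by
  simp only [cross_apply, dotProduct, Fin.sum_univ_three, Matrix.cons_val] at hw ha hb hd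
  ext i
  fin_cases i <;> simp
  · linear_combination (-x 0) * hw + w * (b 1 * d 2 - b 2 * d 1) * ha
      + w * (d 1 * a 2 - d 2 * a 1) * hb + w * (a 1 * b 2 - a 2 * b 1) * hd
  · linear_combination (-x 1) * hw + w * (b 2 * d 0 - b 0 * d 2) * ha
      + w * (d 2 * a 0 - d 0 * a 2) * hb + w * (a 2 * b 0 - a 0 * b 2) * hd
  · linear_combination (-x 2) * hw + w * (b 0 * d 1 - b 1 * d 0) * ha
      + w * (d 0 * a 1 - d 1 * a 0) * hb + w * (a 0 * b 1 - a 1 * b 0) * hd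

/-- This is w × (x × r) = (w·r) x - (w·x) r; the vector w replaces division by a nonzero entry of r.
-/
theorem eq_smul_of_cross_eq_zero {x r w : Fin 3 → R} (hw : w ⬝ᵥ r = 1) (h : x ⨯₃ r = 0) :
    x = (w ⬝ᵥ x) • r := by
  have h0 := congrFun h 0
  have h1 := congrFun h 1
  have h2 := congrFun h 2
  simp [cross_apply] at h0 h1 h2
  simp only [dotProduct, Fin.sum_univ_three] at hw
  ext i
  fin_cases i <;> simp [dotProduct, Fin.sum_univ_three]
  · linear_combination (-x 0) * hw + w 1 * h2 - w 2 * h1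
  · linear_combination (-x 1) * hw - w 0 * h2 + w 2 * h0
  · linear_combination (-x 2) * hw + w 0 * h1 - w 1 * h0

end VectorAlgebra

/-! ### The two-arc equations over an arbitrary ℝ-algebra. -/

section Algebraic

variable {R : Type*} [CommRing R] [Algebra ℝ R]

theorem const_cross (v w : Fin 3 → ℝ) : const R (v ⨯₃ w) = const R v ⨯₃ const R w := by
  ext i
  fin_cases i <;> simp [const, cross_apply]

theorem const_dotProduct (v w : Fin 3 → ℝ) :
    const R v ⬝ᵥ const R w = algebraMap ℝ R (v ⬝ᵥ w) := by
  simp [const, dotProduct, Fin.sum_univ_three]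

theorem const_sub (v w : Fin 3 → ℝ) : const R (v - w) = const R v - const R w := by
  ext i; simp [const]

theorem angMom_sub_angMom (a₁ a₂ : ArcData) (ρ₁ ρ₂ ρ₁' ρ₂' : R) :
    angMom a₁ ρ₁ ρ₁' - angMom a₂ ρ₂ ρ₂' =
      ρ₁' • const R a₁.D - ρ₂' • const R a₂.D - J a₁ a₂ ρ₁ ρ₂ := by
  rw [angMom_eq, angMom_eq, J]
  abel

theorem algebraMap_inv_mul_normSqD {a₁ a₂ : ArcData} (hn : normSqD a₁ a₂ ≠ 0) :
    algebraMap ℝ R (normSqD a₁ a₂)⁻¹ * algebraMap ℝ R (normSqD a₁ a₂) = 1 := by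
  rw [← map_mul, inv_mul_cancel₀ hn, map_one]

/-- The equation to solve is D₁ρ₁' - D₂ρ₂' = 𝐉. In the expansion of 𝐉 by `cramer_cross`, q is the
coefficient along D₁ × D₂ and the other two coefficients are the prescribed radial velocities. -/
theorem angMom_eq_of_qPoly_eq_zero {a₁ a₂ : ArcData} (hn : normSqD a₁ a₂ ≠ 0) {ρ₁ ρ₂ : R}
    (hq : qPoly a₁ a₂ ρ₁ ρ₂ = 0) :
    angMom a₁ ρ₁ (rhoDot₁ a₁ a₂ ρ₁ ρ₂) = angMom a₂ ρ₂ (rhoDot₂ a₁ a₂ ρ₁ ρ₂) := by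
  have hm := algebraMap_inv_mul_normSqD (R := R) hn
  have hc := cramer_cross (const R a₁.D) (const R a₂.D) (J a₁ a₂ ρ₁ ρ₂)
  rw [← const_cross, ← const_cross, ← const_cross, const_dotProduct] at hc
  rw [← sub_eq_zero, angMom_sub_angMom]
  unfold rhoDot₁ rhoDot₂
  unfold qPoly at hq
  rw [hq, zero_smul, add_zero] at hc
  rw [mul_smul, mul_smul, ← smul_sub, ← hc, smul_smul]
  change (algebraMap ℝ R (normSqD a₁ a₂)⁻¹ * algebraMap ℝ R (normSqD a₁ a₂)) • _ - _ = _
  rw [hm, one_smul, sub_self]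

theorem qPoly_eq_zero_of_angMom_eq {a₁ a₂ : ArcData} {ρ₁ ρ₂ ρ₁' ρ₂' : R}
    (h : angMom a₁ ρ₁ ρ₁' = angMom a₂ ρ₂ ρ₂') : qPoly a₁ a₂ ρ₁ ρ₂ = 0 := by
  rw [← sub_eq_zero, angMom_sub_angMom, sub_eq_zero] at h
  rw [qPoly, ← h, const_cross]
  simp [cross_apply, dotProduct, Fin.sum_univ_three]
  ring

theorem rhoDot₁_eq_of_angMom_eq {a₁ a₂ : ArcData} (hn : normSqD a₁ a₂ ≠ 0) {ρ₁ ρ₂ ρ₁' ρ₂' : R}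
    (h : angMom a₁ ρ₁ ρ₁' = angMom a₂ ρ₂ ρ₂') : rhoDot₁ a₁ a₂ ρ₁ ρ₂ = ρ₁' := by
  have hm := algebraMap_inv_mul_normSqD (R := R) hn
  rw [← sub_eq_zero, angMom_sub_angMom, sub_eq_zero] at h
  rw [rhoDot₁, ← h]
  rw [normSqD, ← const_dotProduct, ← normSqD, const_cross] at hm
  rw [const_cross, const_cross]
  simp [cross_apply, dotProduct, Fin.sum_univ_three] at hm ⊢
  linear_combination ρ₁' * hm

theorem rhoDot₂_eq_of_angMom_eq {a₁ a₂ : ArcData} (hn : normSqD a₁ a₂ ≠ 0) {ρ₁ ρ₂ ρ₁' ρ₂' : R}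
    (h : angMom a₁ ρ₁ ρ₁' = angMom a₂ ρ₂ ρ₂') : rhoDot₂ a₁ a₂ ρ₁ ρ₂ = ρ₂' := by
  have hm := algebraMap_inv_mul_normSqD (R := R) hn
  rw [← sub_eq_zero, angMom_sub_angMom, sub_eq_zero] at h
  rw [rhoDot₂, ← h]
  rw [normSqD, ← const_dotProduct, ← normSqD, const_cross] at hm
  rw [const_cross, const_cross]
  simp [cross_apply, dotProduct, Fin.sum_univ_three] at hm ⊢
  linear_combination ρ₂' * hm

/-- Positions and velocities of both arcs are orthogonal to the common 𝐜, and (x × y) × 𝐜 = (x·𝐜) y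
- (y·𝐜) x kills every term of ξ. -/
theorem xi_cross_angMom {a₁ a₂ : ArcData} {ρ₁ ρ₂ ρ₁' ρ₂' : R}
    (h : angMom a₁ ρ₁ ρ₁' = angMom a₂ ρ₂ ρ₂') :
    xi a₁ a₂ ρ₁ ρ₂ ρ₁' ρ₂' ⨯₃ angMom a₁ ρ₁ ρ₁' = 0 := by
  have perp : ∀ r v : Fin 3 → R, r ⬝ᵥ (r ⨯₃ v) = 0 ∧ v ⬝ᵥ (r ⨯₃ v) = 0 := fun r v => by
    constructor <;> simp
  have key : ∀ x y c : Fin 3 → R, x ⬝ᵥ c = 0 → y ⬝ᵥ c = 0 → (x ⨯₃ y) ⨯₃ c = 0 := by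
    intro x y c hx hy
    simp only [dotProduct, Fin.sum_univ_three] at hx hy
    ext i
    fin_cases i <;> simp [cross_apply]
    · linear_combination y 0 * hx - x 0 * hy
    · linear_combination y 1 * hx - x 1 * hy
    · linear_combination y 2 * hx - x 2 * hy
  obtain ⟨hr₁, hv₁⟩ := perp (pos a₁ ρ₁) (vel a₁ ρ₁ ρ₁')
  obtain ⟨hr₂, hv₂⟩ := perp (pos a₂ ρ₂) (vel a₂ ρ₂ ρ₂')
  change _ ⬝ᵥ angMom a₁ ρ₁ ρ₁' = 0 at hr₁ hv₁
  change _ ⬝ᵥ angMom a₂ ρ₂ ρ₂' = 0 at hr₂ hv₂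
  rw [← h] at hr₂ hv₂
  unfold xi
  simp only [map_add, map_sub, map_smul, LinearMap.add_apply, LinearMap.sub_apply,
    LinearMap.smul_apply]
  rw [key _ _ _ hr₁ hr₂, key _ _ _ hv₁ hr₁, key _ _ _ hv₁ hr₂, key _ _ _ hv₂ hr₁,
    key _ _ _ hv₂ hr₂]
  simp

/-- On the conic `q = 0` the vector `ξ` is parallel to the common angular momentum. -/
theorem xi_dotProduct_mul {a₁ a₂ : ArcData} {ρ₁ ρ₂ ρ₁' ρ₂' : R}
    (h : angMom a₁ ρ₁ ρ₁' = angMom a₂ ρ₂ ρ₂') (v w : Fin 3 → R) :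
    (xi a₁ a₂ ρ₁ ρ₂ ρ₁' ρ₂' ⬝ᵥ v) * (angMom a₂ ρ₂ ρ₂' ⬝ᵥ w) =
      (xi a₁ a₂ ρ₁ ρ₂ ρ₁' ρ₂' ⬝ᵥ w) * (angMom a₁ ρ₁ ρ₁' ⬝ᵥ v) := by
  have h3 := xi_cross_angMom h
  rw [← h]
  generalize xi a₁ a₂ ρ₁ ρ₂ ρ₁' ρ₂' = x at *
  generalize angMom a₁ ρ₁ ρ₁' = c at *
  have h0 := congrFun h3 0
  have h1 := congrFun h3 1
  have h2 := congrFun h3 2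
  simp [cross_apply] at h0 h1 h2
  simp only [dotProduct, Fin.sum_univ_three]
  linear_combination (v 1 * w 2 - v 2 * w 1) * h0 + (v 2 * w 0 - v 0 * w 2) * h1
    + (v 0 * w 1 - v 1 * w 0) * h2

theorem angMom_dotProduct_e (a : ArcData) (ρ ρ' : R) :
    angMom a ρ ρ' ⬝ᵥ const R a.e =
      algebraMap ℝ R (a.F ⬝ᵥ a.e) * ρ + algebraMap ℝ R (a.G ⬝ᵥ a.e) := by
  simp [angMom, pos, vel, const, ArcData.F, ArcData.G, cross_apply, dotProduct,
    Fin.sum_univ_three]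
  ring

/-- Here q = (𝐜₂ - 𝐜₁)·(D₁ × D₂). Since D₁ = 𝐫₁ × e₁ and 𝐜₁·𝐫₁ = 0, 𝐜₁·(D₁ × D₂) = (𝐜₁·e₁)(𝐫₁·D₂),
and similarly for the second arc with the opposite sign. -/
theorem qPoly_eq (a₁ a₂ : ArcData) (ρ₁ ρ₂ : R) :
    qPoly a₁ a₂ ρ₁ ρ₂ =
      - (algebraMap ℝ R (a₂.F ⬝ᵥ a₂.e) * ρ₂ + algebraMap ℝ R (a₂.G ⬝ᵥ a₂.e)) *
          (pos a₂ ρ₂ ⬝ᵥ const R a₁.D)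
      - (algebraMap ℝ R (a₁.F ⬝ᵥ a₁.e) * ρ₁ + algebraMap ℝ R (a₁.G ⬝ᵥ a₁.e)) *
          (pos a₁ ρ₁ ⬝ᵥ const R a₂.D) := by
  simp [qPoly, J, pos, const, ArcData.E, ArcData.F, ArcData.G, ArcData.D, cross_apply, dotProduct,
    Fin.sum_univ_three]
  ring

theorem xi_dotProduct_pos_sub_pos (a₁ a₂ : ArcData) (ρ₁ ρ₂ ρ₁' ρ₂' : R) :
    xi a₁ a₂ ρ₁ ρ₂ ρ₁' ρ₂' ⬝ᵥ (pos a₁ ρ₁ - pos a₂ ρ₂) = 0 := by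
  rw [xi_eq a₁ a₂ ρ₁ ρ₂ ρ₁' ρ₂' 0 0, dotProduct_comm, dot_cross_self]

/-- The third direction comes for free: ξ is orthogonal to 𝐫₁ - 𝐫₂, which is 𝐪₁ - 𝐪₂ modulo e₁ and
e₂. -/
theorem xi_eq_zero {a₁ a₂ : ArcData} (hw : (a₁.e ⨯₃ a₂.e) ⬝ᵥ (a₁.q - a₂.q) ≠ 0)
    {ρ₁ ρ₂ ρ₁' ρ₂' : R} (h₁ : xi a₁ a₂ ρ₁ ρ₂ ρ₁' ρ₂' ⬝ᵥ const R a₁.e = 0)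
    (h₂ : xi a₁ a₂ ρ₁ ρ₂ ρ₁' ρ₂' ⬝ᵥ const R a₂.e = 0) :
    xi a₁ a₂ ρ₁ ρ₂ ρ₁' ρ₂' = 0 := by
  refine eq_zero_of_dotProduct_eq_zero (a := const R a₁.e) (b := const R a₂.e)
    (d := const R (a₁.q - a₂.q)) (w := algebraMap ℝ R ((a₁.e ⨯₃ a₂.e) ⬝ᵥ (a₁.q - a₂.q))⁻¹)
    ?_ h₁ h₂ ?_
  · rw [← const_cross, const_dotProduct, ← map_mul, inv_mul_cancel₀ hw, map_one]
  · have h := xi_dotProduct_pos_sub_pos a₁ a₂ ρ₁ ρ₂ ρ₁' ρ₂'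
    have e : pos a₁ ρ₁ - pos a₂ ρ₂ =
        const R (a₁.q - a₂.q) + ρ₁ • const R a₁.e - ρ₂ • const R a₂.e := by
      rw [const_sub, pos, pos]; abel
    rw [e, dotProduct_sub, dotProduct_add, dotProduct_smul, dotProduct_smul, h₁, h₂] at h
    simpa using h

/-- When `ξ` vanishes, the unknowns `z₁, z₂` can be chosen so that the energies and the
Laplace-Lenz vectors agree. -/
theorem exists_energy_eq_muLenz_eq {a₁ a₂ : ArcData}
    (hw : (a₁.e ⨯₃ a₂.e) ⬝ᵥ (a₁.q - a₂.q) ≠ 0) {ρ₁ ρ₂ ρ₁' ρ₂' : R}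
    (hxi : xi a₁ a₂ ρ₁ ρ₂ ρ₁' ρ₂' = 0) :
    ∃ z₁ z₂ : R, energy a₁ ρ₁ ρ₁' z₁ = energy a₂ ρ₂ ρ₂' z₂ ∧
      muLenz a₁ ρ₁ ρ₁' z₁ = muLenz a₂ ρ₂ ρ₂' z₂ := by
  set r := pos a₁ ρ₁ - pos a₂ ρ₂ with hr
  have hwr : (algebraMap ℝ R ((a₁.e ⨯₃ a₂.e) ⬝ᵥ (a₁.q - a₂.q))⁻¹ •
      (const R (a₁.e ⨯₃ a₂.e))) ⬝ᵥ r = 1 := by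
    have e : r = const R (a₁.q - a₂.q) + ρ₁ • const R a₁.e - ρ₂ • const R a₂.e := by
      rw [hr, const_sub, pos, pos]; abel
    have e₁ : const R (a₁.e ⨯₃ a₂.e) ⬝ᵥ const R a₁.e = 0 := by
      rw [const_dotProduct, dotProduct_comm, dot_self_cross, map_zero]
    have e₂ : const R (a₁.e ⨯₃ a₂.e) ⬝ᵥ const R a₂.e = 0 := by
      rw [const_dotProduct, dotProduct_comm, dot_cross_self, map_zero]
    rw [smul_dotProduct, e, dotProduct_sub (const R _), dotProduct_add (const R _), dotProduct_smul, dotProduct_smul, e₁,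
      e₂, const_dotProduct]
    simp only [smul_eq_mul, mul_zero, add_zero, sub_zero]
    rw [← map_mul, inv_mul_cancel₀ hw, map_one]
  set w := algebraMap ℝ R ((a₁.e ⨯₃ a₂.e) ⬝ᵥ (a₁.q - a₂.q))⁻¹ • (const R (a₁.e ⨯₃ a₂.e))
  -- With z₁ = k₁ and z₂ = k₂ both energies are zero, so ξ = 0 makes the difference of the Lenz
  -- vectors a multiple t(𝐫₁ - 𝐫₂). Adding t to both z's keeps the energies equal and subtracts t𝐫ⱼ
  -- from each Lenz vector.
  set k₁ := algebraMap ℝ R (1 / 2) * (vel a₁ ρ₁ ρ₁' ⬝ᵥ vel a₁ ρ₁ ρ₁') with hk₁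
  set k₂ := algebraMap ℝ R (1 / 2) * (vel a₂ ρ₂ ρ₂' ⬝ᵥ vel a₂ ρ₂ ρ₂') with hk₂
  have he : energy a₁ ρ₁ ρ₁' k₁ = 0 ∧ energy a₂ ρ₂ ρ₂' k₂ = 0 := by
    simp [energy, hk₁, hk₂]
  have hx := xi_eq a₁ a₂ ρ₁ ρ₂ ρ₁' ρ₂' k₁ k₂
  rw [hxi, he.1, he.2, zero_smul, zero_smul, sub_zero, sub_zero] at hx
  have hs := eq_smul_of_cross_eq_zero hwr hx.symm
  set t := w ⬝ᵥ (muLenz a₁ ρ₁ ρ₁' k₁ - muLenz a₂ ρ₂ ρ₂' k₂)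
  refine ⟨k₁ + t, k₂ + t, ?_, ?_⟩
  · have h₁ := he.1
    have h₂ := he.2
    unfold energy at *
    linear_combination h₁ - h₂
  · have expand : ∀ (a : ArcData) (ρ ρ' z : R),
        muLenz a ρ ρ' (z + t) = muLenz a ρ ρ' z - t • pos a ρ := by
      intro a ρ ρ' z
      simp only [muLenz, sub_smul, add_smul]
      abel
    rw [expand, expand, ← sub_eq_zero]
    rw [hr, smul_sub] at hs
    rw [show muLenz a₁ ρ₁ ρ₁' k₁ - t • pos a₁ ρ₁ - (muLenz a₂ ρ₂ ρ₂' k₂ - t • pos a₂ ρ₂) =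
      muLenz a₁ ρ₁ ρ₁' k₁ - muLenz a₂ ρ₂ ρ₂' k₂ - (t • pos a₁ ρ₁ - t • pos a₂ ρ₂) by abel,
      ← hs, sub_self]

end Algebraic

/-! ### Compatibility of all constructions with ℝ-algebra homomorphisms. -/

section Naturality

variable {R S : Type*} [CommRing R] [Algebra ℝ R] [CommRing S] [Algebra ℝ S] (φ : R →ₐ[ℝ] S)

theorem comp_const (v : Fin 3 → ℝ) : φ ∘ const R v = const S v := by
  ext i; simp [const]

theorem comp_pos (a : ArcData) (ρ : R) : φ ∘ pos a ρ = pos a (φ ρ) := by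
  ext i; simp [pos, const]

theorem comp_vel (a : ArcData) (ρ ρ' : R) : φ ∘ vel a ρ ρ' = vel a (φ ρ) (φ ρ') := by
  ext i; simp [vel, const]

theorem comp_cross (v w : Fin 3 → R) : φ ∘ (v ⨯₃ w) = (φ ∘ v) ⨯₃ (φ ∘ w) := by
  ext i; fin_cases i <;> simp [cross_apply]

theorem comp_smul (r : R) (v : Fin 3 → R) : φ ∘ (r • v) = φ r • (φ ∘ v) := by
  ext i; simp

theorem comp_add (v w : Fin 3 → R) : φ ∘ (v + w) = φ ∘ v + φ ∘ w := by
  ext i; simp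

theorem comp_sub (v w : Fin 3 → R) : φ ∘ (v - w) = φ ∘ v - φ ∘ w := by
  ext i; simp

theorem map_dotProduct (v w : Fin 3 → R) : φ (v ⬝ᵥ w) = (φ ∘ v) ⬝ᵥ (φ ∘ w) := by
  simp [dotProduct]

theorem comp_angMom (a : ArcData) (ρ ρ' : R) : φ ∘ angMom a ρ ρ' = angMom a (φ ρ) (φ ρ') := by
  simp only [angMom, comp_cross, comp_pos, comp_vel]

theorem map_energy (a : ArcData) (ρ ρ' z : R) :
    φ (energy a ρ ρ' z) = energy a (φ ρ) (φ ρ') (φ z) := by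
  simp only [energy, map_sub, map_mul, map_dotProduct, comp_vel, AlgHom.commutes]

theorem comp_muLenz (a : ArcData) (ρ ρ' z : R) :
    φ ∘ muLenz a ρ ρ' z = muLenz a (φ ρ) (φ ρ') (φ z) := by
  simp only [muLenz, comp_sub, comp_smul, map_sub, map_dotProduct, comp_vel, comp_pos]

theorem comp_J (a₁ a₂ : ArcData) (ρ₁ ρ₂ : R) : φ ∘ J a₁ a₂ ρ₁ ρ₂ = J a₁ a₂ (φ ρ₁) (φ ρ₂) := by
  simp only [J, comp_sub, comp_add, comp_smul, map_pow, comp_const]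

theorem map_qPoly (a₁ a₂ : ArcData) (ρ₁ ρ₂ : R) :
    φ (qPoly a₁ a₂ ρ₁ ρ₂) = qPoly a₁ a₂ (φ ρ₁) (φ ρ₂) := by
  simp only [qPoly, map_dotProduct, comp_J, comp_const]

theorem map_rhoDot₁ (a₁ a₂ : ArcData) (ρ₁ ρ₂ : R) :
    φ (rhoDot₁ a₁ a₂ ρ₁ ρ₂) = rhoDot₁ a₁ a₂ (φ ρ₁) (φ ρ₂) := by
  simp only [rhoDot₁, map_mul, map_dotProduct, comp_J, comp_const, AlgHom.commutes]

theorem map_rhoDot₂ (a₁ a₂ : ArcData) (ρ₁ ρ₂ : R) :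
    φ (rhoDot₂ a₁ a₂ ρ₁ ρ₂) = rhoDot₂ a₁ a₂ (φ ρ₁) (φ ρ₂) := by
  simp only [rhoDot₂, map_mul, map_dotProduct, comp_J, comp_const, AlgHom.commutes]

theorem comp_xi (a₁ a₂ : ArcData) (ρ₁ ρ₂ ρ₁' ρ₂' : R) :
    φ ∘ xi a₁ a₂ ρ₁ ρ₂ ρ₁' ρ₂' = xi a₁ a₂ (φ ρ₁) (φ ρ₂) (φ ρ₁') (φ ρ₂') := by
  simp only [xi, comp_sub, comp_add, comp_smul, map_mul, map_sub, map_dotProduct, comp_vel,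
    comp_pos, comp_cross, AlgHom.commutes]

end Naturality

noncomputable section

open Polynomial

/-! ### Degrees of resultants, and resultants up to units. -/

section Resultant

variable {K : Type*} [CommRing K]

/-- With row weights r and column weights c, every nonzero product in the Leibniz formula has the
same degree bound, whatever the permutation. -/
theorem natDegree_det_le {k : ℕ} (M : Matrix (Fin k) (Fin k) K[X]) (r c : Fin k → ℕ)
    (h : ∀ i j, M i j ≠ 0 → (M i j).natDegree + r i ≤ c j) :
    M.det.natDegree ≤ ∑ j, c j - ∑ i, r i := by
  rw [Matrix.det_apply]
  refine natDegree_sum_le_of_forall_le _ _ fun σ _ => ?_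
  refine (natDegree_smul_le _ _).trans ?_
  by_cases h0 : ∃ i, M (σ i) i = 0
  · obtain ⟨i, hi⟩ := h0
    have hz : ∏ i, M (σ i) i = 0 := Finset.prod_eq_zero (Finset.mem_univ i) hi
    exact (congrArg natDegree hz).trans_le (by simp)
  · push Not at h0
    refine (natDegree_prod_le _ _).trans ?_
    refine Nat.le_sub_of_add_le ?_
    rw [← Equiv.sum_comp σ r, ← Finset.sum_add_distrib]
    exact Finset.sum_le_sum fun i _ => h _ _ (h0 i)

/-- The bivariate polynomial `F` has total degree at most `d`. -/
def TotalDegreeLE (d : ℕ) (F : K[X][X]) : Prop :=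
  ∀ i j, d < i + j → (F.coeff i).coeff j = 0

namespace TotalDegreeLE

variable {d e : ℕ} {F G : K[X][X]}

theorem add (hF : TotalDegreeLE d F) (hG : TotalDegreeLE d G) : TotalDegreeLE d (F + G) :=
  fun i j h => by simp [hF i j h, hG i j h]

theorem sub (hF : TotalDegreeLE d F) (hG : TotalDegreeLE d G) : TotalDegreeLE d (F - G) :=
  fun i j h => by simp [hF i j h, hG i j h]

theorem mono (hF : TotalDegreeLE d F) (h : d ≤ e) : TotalDegreeLE e F :=
  fun i j hij => hF i j (h.trans_lt hij)

theorem mul (hF : TotalDegreeLE d F) (hG : TotalDegreeLE e G) :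
    TotalDegreeLE (d + e) (F * G) := by
  intro i j h
  rw [coeff_mul, finsetSum_coeff]
  refine Finset.sum_eq_zero fun x hx => ?_
  rw [coeff_mul]
  refine Finset.sum_eq_zero fun y hy => ?_
  rw [Finset.HasAntidiagonal.mem_antidiagonal] at hx hy
  rcases le_or_gt (x.1 + y.1) d with h1 | h1
  · rw [hG x.2 y.2 (by omega), mul_zero]
  · rw [hF x.1 y.1 h1, zero_mul]

theorem C_C (r : K) : TotalDegreeLE 0 (C (C r)) := by
  intro i j h
  rcases Nat.eq_zero_or_pos i with rfl | hi
  · rw [coeff_C_zero, coeff_C_of_ne_zero (by omega)]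
  · rw [coeff_C_of_ne_zero (by omega), coeff_zero]

theorem X : TotalDegreeLE 1 (X : K[X][X]) := by
  intro i j h
  rw [coeff_X]
  split_ifs with hi
  · subst hi
    rw [coeff_one, if_neg (by omega)]
  · simp

theorem C_X : TotalDegreeLE 1 (C Polynomial.X : K[X][X]) := by
  intro i j h
  rcases Nat.eq_zero_or_pos i with rfl | hi
  · rw [coeff_C_zero, coeff_X, if_neg (by omega)]
  · rw [coeff_C_of_ne_zero (by omega), coeff_zero]

theorem natDegree_le (hF : TotalDegreeLE d F) : F.natDegree ≤ d :=
  natDegree_le_iff_coeff_eq_zero.2 fun i hi => Polynomial.ext fun j => by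
    rw [hF i j (by omega), coeff_zero]

theorem natDegree_coeff_add_le (hF : TotalDegreeLE d F) {i : ℕ} (hi : F.coeff i ≠ 0) :
    (F.coeff i).natDegree + i ≤ d := by
  by_contra h
  refine hi (leadingCoeff_eq_zero.1 ?_)
  exact hF _ _ (by omega)

/-- The Bézout bound. A Sylvester entry in row i is the coefficient of index i - j of F or G, so its
degree is at most m + j - i or n + j - i, which are the weights of `natDegree_det_le`. -/
theorem natDegree_resultant_le {m n : ℕ} (hF : TotalDegreeLE m F) (hG : TotalDegreeLE n G) :
    (resultant F G m n).natDegree ≤ m * n := by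
  refine (natDegree_det_le _ (fun i => (i : ℕ))
    (fun j => j.addCases (fun j => n + (j : ℕ)) (fun j => m + (j : ℕ))) ?_).trans ?_
  · intro i j
    refine j.addCases (fun j => ?_) (fun j => ?_)
    · simp only [sylvester, Matrix.of_apply, Fin.addCases_left]
      split_ifs with h
      · intro h0
        have := hG.natDegree_coeff_add_le h0
        have := h.1
        omega
      · simp
    · simp only [sylvester, Matrix.of_apply, Fin.addCases_right]
      split_ifs with h
      · intro h0
        have := hF.natDegree_coeff_add_le h0
        have := h.1
        omega
      · simp
  · rw [Fin.sum_univ_add, Fin.sum_univ_add]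
    simp only [Fin.addCases_left, Fin.addCases_right, Fin.val_castAdd, Fin.val_natAdd,
      Finset.sum_add_distrib, Finset.sum_const, Finset.card_univ, Fintype.card_fin, smul_eq_mul]
    omega

end TotalDegreeLE

/-- Raising the formal degree of f only multiplies the resultant by a sign and a power of the
leading coefficient of g, here a unit. This reconciles fixed formal degrees with actual degrees. -/
theorem associated_resultant {f g : K[X]} {n : ℕ} (hn : g.natDegree = n)
    (hu : IsUnit g.leadingCoeff) {m : ℕ} (hm : f.natDegree ≤ m) :
    Associated (resultant f g m n) (resultant f g) := by
  obtain ⟨k, rfl⟩ := Nat.exists_eq_add_of_le hm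
  rw [resultant_add_left_deg _ _ _ _ _ le_rfl, ← hn]
  refine associated_unit_mul_left _ _ (IsUnit.mul ?_ (hu.pow k))
  exact (isUnit_one.neg).pow _

theorem associated_resultant_of_dvd_sub {f f' g : K[X]} (hu : IsUnit g.leadingCoeff)
    (h : g ∣ f - f') : Associated (resultant f g) (resultant f' g) := by
  obtain ⟨k, hk⟩ := h
  obtain rfl : f = f' + g * k := by rw [← hk]; ring
  set m := max (f' + g * k).natDegree (max f'.natDegree (k.natDegree + g.natDegree))
  have h₁ := associated_resultant rfl hu (le_max_left _ _ : (f' + g * k).natDegree ≤ m)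
  have h₂ := associated_resultant rfl hu
    ((le_max_left _ _).trans (le_max_right _ _) : f'.natDegree ≤ m)
  rw [resultant_add_mul_left _ _ _ _ _ ((le_max_right _ _).trans (le_max_right _ _)) le_rfl] at h₁
  exact h₁.symm.trans h₂

theorem associated_resultant_mul {f f' g : K[X]} (hu : IsUnit g.leadingCoeff) :
    Associated (resultant (f * f') g) (resultant f g * resultant f' g) := by
  rw [← resultant_mul_left _ _ _ _ le_rfl]
  exact (associated_resultant rfl hu natDegree_mul_le).symm

end Resultant

/-! ### Evaluating the bivariate polynomials in an ℝ-algebra. -/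

/-- Evaluation of a bivariate polynomial at `ρ₁, ρ₂`. -/
def biEval {R : Type*} [CommRing R] [Algebra ℝ R] (ρ₁ ρ₂ : R) : ℝ[X][X] →ₐ[ℝ] R :=
  { eval₂RingHom (aeval ρ₂ : ℝ[X] →ₐ[ℝ] R).toRingHom ρ₁ with
    commutes' := fun r => by
      change eval₂ _ _ (algebraMap ℝ ℝ[X][X] r) = _
      simp [Polynomial.algebraMap_apply] }

/-- `𝐜₂ · e^ρ₂`, a linear polynomial in `ρ₂`. -/
def linear₂ (a₂ : ArcData) : ℝ[X] := C (a₂.F ⬝ᵥ a₂.e) * X + C (a₂.G ⬝ᵥ a₂.e)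

/-- `𝐜₁ · e^ρ₁`, a linear polynomial in `ρ₁`. -/
def linear₁ (a₁ : ArcData) : ℝ[X][X] := C (C (a₁.F ⬝ᵥ a₁.e)) * X + C (C (a₁.G ⬝ᵥ a₁.e))

section BiEval

variable {R : Type*} [CommRing R] [Algebra ℝ R] (ρ₁ ρ₂ : R) (a₁ a₂ : ArcData)

theorem biEval_apply (F : ℝ[X][X]) :
    biEval ρ₁ ρ₂ F = F.eval₂ (aeval ρ₂ : ℝ[X] →ₐ[ℝ] R).toRingHom ρ₁ := rfl

@[simp]
theorem biEval_biRho₁ : biEval ρ₁ ρ₂ biRho₁ = ρ₁ := by simp [biEval_apply, biRho₁]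

@[simp]
theorem biEval_C (f : ℝ[X]) : biEval ρ₁ ρ₂ (C f) = aeval ρ₂ f := by simp [biEval_apply]

@[simp]
theorem biEval_biRho₂ : biEval ρ₁ ρ₂ biRho₂ = ρ₂ := by simp [biRho₂]

theorem biEval_qBi : biEval ρ₁ ρ₂ (qBi a₁ a₂) = qPoly a₁ a₂ ρ₁ ρ₂ := by
  simp [qBi, map_qPoly]

theorem biEval_p₁ : biEval ρ₁ ρ₂ (p₁ a₁ a₂) =
    xi a₁ a₂ ρ₁ ρ₂ (rhoDot₁ a₁ a₂ ρ₁ ρ₂) (rhoDot₂ a₁ a₂ ρ₁ ρ₂) ⬝ᵥ const R a₁.e := by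
  simp [p₁, xiBi, map_dotProduct, comp_xi, comp_const, map_rhoDot₁, map_rhoDot₂]

theorem biEval_p₂ : biEval ρ₁ ρ₂ (p₂ a₁ a₂) =
    xi a₁ a₂ ρ₁ ρ₂ (rhoDot₁ a₁ a₂ ρ₁ ρ₂) (rhoDot₂ a₁ a₂ ρ₁ ρ₂) ⬝ᵥ const R a₂.e := by
  simp [p₂, xiBi, map_dotProduct, comp_xi, comp_const, map_rhoDot₁, map_rhoDot₂]

theorem biEval_linear₁ : biEval ρ₁ ρ₂ (linear₁ a₁) =
    algebraMap ℝ R (a₁.F ⬝ᵥ a₁.e) * ρ₁ + algebraMap ℝ R (a₁.G ⬝ᵥ a₁.e) := by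
  simp [linear₁, biEval_apply]

theorem aeval_linear₂ : aeval ρ₂ (linear₂ a₂) =
    algebraMap ℝ R (a₂.F ⬝ᵥ a₂.e) * ρ₂ + algebraMap ℝ R (a₂.G ⬝ᵥ a₂.e) := by
  simp [linear₂]

theorem biEval_p₁_mul (hn : normSqD a₁ a₂ ≠ 0) (hq : qPoly a₁ a₂ ρ₁ ρ₂ = 0) :
    biEval ρ₁ ρ₂ (p₁ a₁ a₂ * C (linear₂ a₂)) = biEval ρ₁ ρ₂ (p₂ a₁ a₂ * linear₁ a₁) := by
  rw [map_mul, map_mul, biEval_p₁, biEval_p₂, biEval_linear₁, biEval_C, aeval_linear₂,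
    ← angMom_dotProduct_e a₁ ρ₁ (rhoDot₁ a₁ a₂ ρ₁ ρ₂),
    ← angMom_dotProduct_e a₂ ρ₂ (rhoDot₂ a₁ a₂ ρ₁ ρ₂)]
  exact xi_dotProduct_mul (angMom_eq_of_qPoly_eq_zero hn hq) _ _

end BiEval

/-! ### Total degrees of q and p₂, and the generic conditions. -/

variable (a₁ a₂ : ArcData)

theorem qBi_eq : qBi a₁ a₂ =
    C (C (-(a₁.E ⬝ᵥ (a₁.D ⨯₃ a₂.D)))) * X ^ 2 + C (C (-(a₁.F ⬝ᵥ (a₁.D ⨯₃ a₂.D)))) * X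
      + C (C (a₂.E ⬝ᵥ (a₁.D ⨯₃ a₂.D)) * X ^ 2 + C (a₂.F ⬝ᵥ (a₁.D ⨯₃ a₂.D)) * X
        + C ((a₂.G - a₁.G) ⬝ᵥ (a₁.D ⨯₃ a₂.D))) := by
  simp only [qBi, qPoly, J, const, biRho₁, biRho₂, dotProduct, Fin.sum_univ_three,
    Polynomial.algebraMap_apply, Pi.add_apply, Pi.sub_apply, Pi.smul_apply, smul_eq_mul,
    map_add, map_sub, map_mul, map_neg, map_pow, Algebra.algebraMap_self, RingHom.id_apply]
  ring

theorem totalDegreeLE_qBi : TotalDegreeLE 2 (qBi a₁ a₂) := by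
  have h : ∀ r : ℝ, TotalDegreeLE 0 (C (C r)) := TotalDegreeLE.C_C
  rw [qBi_eq]
  simp only [map_add, map_mul, pow_two]
  exact ((((h _).mul (.mul .X .X)).mono (by norm_num)).add
    (((h _).mul .X).mono (by norm_num))).add
      (((((h _).mul (.mul .C_X .C_X)).mono (by norm_num)).add
        (((h _).mul .C_X).mono (by norm_num))).add ((h _).mono (by norm_num)))

/-- The vector polynomial `v` has entries of total degree at most `d`. -/
def VecDegreeLE (d : ℕ) (v : Fin 3 → ℝ[X][X]) : Prop := ∀ i, TotalDegreeLE d (v i)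

namespace VecDegreeLE

variable {d e : ℕ} {v w : Fin 3 → ℝ[X][X]} {r : ℝ[X][X]}

theorem add (hv : VecDegreeLE d v) (hw : VecDegreeLE d w) : VecDegreeLE d (v + w) :=
  fun i => (hv i).add (hw i)

theorem sub (hv : VecDegreeLE d v) (hw : VecDegreeLE d w) : VecDegreeLE d (v - w) :=
  fun i => (hv i).sub (hw i)

theorem mono (hv : VecDegreeLE d v) (h : d ≤ e) : VecDegreeLE e v := fun i => (hv i).mono h

theorem smul (hr : TotalDegreeLE d r) (hv : VecDegreeLE e v) : VecDegreeLE (d + e) (r • v) :=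
  fun i => hr.mul (hv i)

theorem dotProduct (hv : VecDegreeLE d v) (hw : VecDegreeLE e w) :
    TotalDegreeLE (d + e) (v ⬝ᵥ w) := by
  simp only [_root_.dotProduct, Fin.sum_univ_three]
  exact (((hv 0).mul (hw 0)).add ((hv 1).mul (hw 1))).add ((hv 2).mul (hw 2))

theorem cross (hv : VecDegreeLE d v) (hw : VecDegreeLE e w) :
    VecDegreeLE (d + e) (v ⨯₃ w) := by
  have h : ∀ i j k l, TotalDegreeLE (d + e) (v i * w j - v k * w l) := fun i j k l =>
    ((hv i).mul (hw j)).sub ((hv k).mul (hw l))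
  intro i
  fin_cases i <;> simp only [cross_apply] <;> exact h _ _ _ _

theorem const (v : Fin 3 → ℝ) : VecDegreeLE 0 (const ℝ[X][X] v) := fun i => by
  have := TotalDegreeLE.C_C (v i)
  simpa [KeplerLinkage.const, Polynomial.algebraMap_apply] using this

end VecDegreeLE

/-- In a triple product with e₂ the e₂-components of 𝐫₂ and 𝐫₂' drop out, and so does e₁ × e₁ from
𝐫₁' × (𝐫₁ - 𝐫₂). These cancellations lower the total degree of p₂ to 5. -/
theorem xi_dotProduct_e_right {R : Type*} [CommRing R] [Algebra ℝ R] (ρ₁ ρ₂ ρ₁' ρ₂' : R) :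
    xi a₁ a₂ ρ₁ ρ₂ ρ₁' ρ₂' ⬝ᵥ const R a₂.e =
      algebraMap ℝ R (1 / 2) *
          (vel a₂ ρ₂ ρ₂' ⬝ᵥ vel a₂ ρ₂ ρ₂' - vel a₁ ρ₁ ρ₁' ⬝ᵥ vel a₁ ρ₁ ρ₁') *
          ((pos a₁ ρ₁ ⨯₃ const R a₂.q) ⬝ᵥ const R a₂.e)
        - (vel a₁ ρ₁ ρ₁' ⬝ᵥ pos a₁ ρ₁) *
          (((const R a₁.qDot + ρ₁ • const R a₁.ePerp) ⨯₃ (pos a₁ ρ₁ - const R a₂.q)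
              + ρ₁' • (const R a₁.e ⨯₃ const R (a₁.q - a₂.q))) ⬝ᵥ const R a₂.e)
        + (vel a₂ ρ₂ ρ₂' ⬝ᵥ pos a₂ ρ₂) *
          (((const R a₂.qDot + ρ₂ • const R a₂.ePerp) ⨯₃ (pos a₁ ρ₁ - const R a₂.q))
            ⬝ᵥ const R a₂.e) := by
  unfold xi
  simp only [add_dotProduct, sub_dotProduct, smul_dotProduct, smul_eq_mul]
  congr 1
  · congr 1
    · congr 1
      simp [pos, const, cross_apply, dotProduct, Fin.sum_univ_three]
      ring
    · congr 1
      simp [vel, pos, const, cross_apply, dotProduct, Fin.sum_univ_three]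
      ring
  · congr 1
    simp [vel, pos, const, cross_apply, dotProduct, Fin.sum_univ_three]
    ring

theorem totalDegreeLE_p₂ : TotalDegreeLE 5 (p₂ a₁ a₂) := by
  have hc := VecDegreeLE.const
  have hs : ∀ r : ℝ, TotalDegreeLE 0 (algebraMap ℝ ℝ[X][X] r) := fun r => by
    simpa [Polynomial.algebraMap_apply] using TotalDegreeLE.C_C r
  have hX : TotalDegreeLE 1 biRho₁ := .X
  have hY : TotalDegreeLE 1 biRho₂ := .C_X
  have hJ : VecDegreeLE 2 (J a₁ a₂ biRho₁ biRho₂) := by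
    have h1 : TotalDegreeLE 2 (biRho₁ ^ 2) := by rw [pow_two]; exact hX.mul hX
    have h2 : TotalDegreeLE 2 (biRho₂ ^ 2) := by rw [pow_two]; exact hY.mul hY
    exact ((((((VecDegreeLE.smul h2 (hc _)).sub (VecDegreeLE.smul h1 (hc _))).add
      ((VecDegreeLE.smul hY (hc _)).mono one_le_two)).sub
      ((VecDegreeLE.smul hX (hc _)).mono one_le_two)).add ((hc _).mono (by norm_num))).sub
      ((hc _).mono (by norm_num)))
  have hd₁ : TotalDegreeLE 2 (rhoDot₁ a₁ a₂ biRho₁ biRho₂) :=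
    ((hs _).mul (hJ.dotProduct (hc _))).mono (by norm_num)
  have hd₂ : TotalDegreeLE 2 (rhoDot₂ a₁ a₂ biRho₁ biRho₂) :=
    ((hs _).mul (hJ.dotProduct (hc _))).mono (by norm_num)
  have hp : ∀ (a : ArcData) {r}, TotalDegreeLE 1 r → VecDegreeLE 1 (pos a r) := fun a r hr =>
    ((hc _).mono zero_le_one).add (VecDegreeLE.smul hr (hc _))
  have hw : ∀ (a : ArcData) {r}, TotalDegreeLE 1 r →
      VecDegreeLE 1 (const ℝ[X][X] a.qDot + r • const ℝ[X][X] a.ePerp) := fun a r hr =>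
    ((hc _).mono zero_le_one).add (VecDegreeLE.smul hr (hc _))
  have hv : ∀ (a : ArcData) {r r'}, TotalDegreeLE 1 r → TotalDegreeLE 2 r' →
      VecDegreeLE 2 (vel a r r') := fun a r r' hr hr' =>
    (((hc _).mono (by norm_num)).add (VecDegreeLE.smul hr' (hc _))).add
      ((VecDegreeLE.smul hr (hc _)).mono one_le_two)
  have hv₁ := hv a₁ hX hd₁
  have hv₂ := hv a₂ hY hd₂
  have hp₁ := hp a₁ hX
  have hp₂ := hp a₂ hY
  have hpq : VecDegreeLE 1 (pos a₁ biRho₁ - const ℝ[X][X] a₂.q) :=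
    hp₁.sub ((hc _).mono zero_le_one)
  rw [p₂, xiBi, xi_dotProduct_e_right]
  refine TotalDegreeLE.add (TotalDegreeLE.sub ?_ ?_) ?_
  · exact ((hs _).mul ((hv₂.dotProduct hv₂).sub (hv₁.dotProduct hv₁))).mul
      ((hp₁.cross (hc _)).dotProduct (hc _))
  · exact (hv₁.dotProduct hp₁).mul
      ((((hw a₁ hX).cross hpq).add ((VecDegreeLE.smul hd₁ ((hc _).cross (hc _))).mono
        (by norm_num))).dotProduct (hc _))
  · exact (hv₂.dotProduct hp₂).mul (((hw a₂ hY).cross hpq).dotProduct (hc _))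

/-- The resultant of `p₂` and `q` for the formal degrees `5` and `2`. -/
def formalU₂ : ℝ[X] := resultant (p₂ a₁ a₂) (qBi a₁ a₂) 5 2

/-- The open condition under which the elimination behaves as in the generic case. -/
structure IsGeneric : Prop where
  normSqD_ne : normSqD a₁ a₂ ≠ 0
  coeff_ne : a₁.E ⬝ᵥ (a₁.D ⨯₃ a₂.D) ≠ 0
  left_ne : a₁.F ⬝ᵥ a₁.e ≠ 0
  right_ne : a₂.F ⬝ᵥ a₂.e ≠ 0
  triple_ne : (a₁.e ⨯₃ a₂.e) ⬝ᵥ (a₁.q - a₂.q) ≠ 0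
  linear_ne : (a₂.F ⬝ᵥ a₂.e) * (a₂.q ⬝ᵥ a₁.D) - (a₂.G ⬝ᵥ a₂.e) * (a₂.e ⬝ᵥ a₁.D) ≠ 0
  discr_ne : resultant (formalU₂ a₁ a₂) (derivative (formalU₂ a₁ a₂)) 10 9 ≠ 0

/-- `𝐫₂ · D₁`, a linear polynomial in `ρ₂`. -/
def cofactor₂ : ℝ[X] := C (a₂.q ⬝ᵥ a₁.D) + C (a₂.e ⬝ᵥ a₁.D) * X

/-! ### The factorization of 𝔲₂ and the degree of 𝔲. -/

namespace IsGeneric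

variable {a₁ a₂} (h : IsGeneric a₁ a₂)
include h

theorem natDegree_qBi : (qBi a₁ a₂).natDegree = 2 := by
  rw [qBi_eq]
  exact natDegree_quadratic (by simpa using h.coeff_ne)

theorem isUnit_leadingCoeff_qBi : IsUnit (qBi a₁ a₂).leadingCoeff := by
  rw [qBi_eq, leadingCoeff_quadratic (by simpa using h.coeff_ne)]
  exact isUnit_C.2 (isUnit_iff_ne_zero.2 (neg_ne_zero.2 h.coeff_ne))

/-- The discriminant is taken with formal degrees 10 and 9, so it also vanishes when the degree
drops below 10. -/
theorem natDegree_formalU₂ : (formalU₂ a₁ a₂).natDegree = 10 := by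
  have hle : (formalU₂ a₁ a₂).natDegree ≤ 10 :=
    (totalDegreeLE_p₂ a₁ a₂).natDegree_resultant_le (totalDegreeLE_qBi a₁ a₂)
  by_contra hne
  refine h.discr_ne (resultant_eq_zero_of_lt_lt _ _ _ _ (lt_of_le_of_ne hle hne) ?_)
  have := natDegree_derivative_le (formalU₂ a₁ a₂)
  omega

theorem separable_formalU₂ : (formalU₂ a₁ a₂).Separable := by
  have h₁ := h.natDegree_formalU₂
  have h₂ : (derivative (formalU₂ a₁ a₂)).natDegree = 9 := by
    rw [natDegree_derivative, h₁]
  have h₃ := h.discr_ne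
  rw [← h₁, ← h₂, Ne, resultant_eq_zero_iff, not_and_not_right] at h₃
  refine h₃ (Or.inl ?_)
  rintro h0
  rw [h0, natDegree_zero] at h₁
  norm_num at h₁

theorem associated_formalU₂ : Associated (formalU₂ a₁ a₂) (u₂ a₁ a₂) :=
  associated_resultant h.natDegree_qBi h.isUnit_leadingCoeff_qBi
    (totalDegreeLE_p₂ a₁ a₂).natDegree_le

/-- The identity `biEval_p₁_mul` is applied at the classes of ρ₁, ρ₂ in the quotient by q, a
tautological point of the conic. -/
theorem qBi_dvd : qBi a₁ a₂ ∣ p₁ a₁ a₂ * C (linear₂ a₂) - p₂ a₁ a₂ * linear₁ a₁ := by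
  rw [← Ideal.mem_span_singleton, ← Ideal.Quotient.eq_zero_iff_mem]
  set I := Ideal.span {qBi a₁ a₂}
  let φ : ℝ[X][X] →ₐ[ℝ] ℝ[X][X] ⧸ I := Ideal.Quotient.mkₐ ℝ I
  -- An ℝ-algebra homomorphism is determined by the images of ρ₁ and ρ₂.
  have hφ : φ = biEval (φ biRho₁) (φ biRho₂) := by
    refine AlgHom.coe_ringHom_injective (Polynomial.ringHom_ext' ?_ ?_)
    · refine Polynomial.ringHom_ext' ?_ ?_
      · ext r
        have h₁ : (C (C r) : ℝ[X][X]) = algebraMap ℝ _ r := by simp [Polynomial.algebraMap_apply]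
        change φ (C (C r)) = biEval (φ biRho₁) (φ biRho₂) (C (C r))
        rw [h₁, AlgHom.commutes, AlgHom.commutes]
      · change φ biRho₂ = biEval (φ biRho₁) (φ biRho₂) biRho₂
        rw [biEval_biRho₂]
    · change φ biRho₁ = biEval (φ biRho₁) (φ biRho₂) biRho₁
      rw [biEval_biRho₁]
  have hq : qPoly a₁ a₂ (φ biRho₁) (φ biRho₂) = 0 := by
    rw [← biEval_qBi, ← hφ]
    exact Ideal.Quotient.eq_zero_iff_mem.2 (Ideal.subset_span rfl)
  change φ _ = 0
  rw [map_sub, sub_eq_zero, hφ]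
  exact biEval_p₁_mul _ _ a₁ a₂ h.normSqD_ne hq

theorem natDegree_linear₁ : (linear₁ a₁).natDegree = 1 := by
  rw [linear₁]
  exact natDegree_linear (by simpa using h.left_ne)

theorem natDegree_linear₂ : (linear₂ a₂).natDegree = 1 := natDegree_linear h.right_ne

theorem linear₂_ne_zero : linear₂ a₂ ≠ 0 := fun h0 => by
  have := h.natDegree_linear₂
  rw [h0, natDegree_zero] at this
  exact zero_ne_one this

/-- By `qPoly_eq`, q is congruent modulo 𝐜₁·e₁ to an expression free of ρ₁, and the resultant with a
constant is immediate. -/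
theorem associated_resultant_linear₁ :
    Associated (resultant (linear₁ a₁) (qBi a₁ a₂)) (linear₂ a₂ * cofactor₂ a₁ a₂) := by
  have hq : qBi a₁ a₂ = C (-(linear₂ a₂ * cofactor₂ a₁ a₂)) +
      linear₁ a₁ * (-(C (C (a₁.q ⬝ᵥ a₂.D)) + C (C (a₁.e ⬝ᵥ a₂.D)) * X)) := by
    rw [qBi, qPoly_eq]
    simp only [pos, const, biRho₁, biRho₂, linear₁, linear₂, cofactor₂, dotProduct,
      Fin.sum_univ_three, Polynomial.algebraMap_apply, Pi.add_apply, Pi.smul_apply, smul_eq_mul,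
      map_add, map_mul, map_neg, Algebra.algebraMap_self, RingHom.id_apply]
    ring
  have hd : (-(C (C (a₁.q ⬝ᵥ a₂.D)) + C (C (a₁.e ⬝ᵥ a₂.D)) * X) : ℝ[X][X]).natDegree ≤ 1 := by
    rw [natDegree_neg, add_comm]
    exact natDegree_linear_le
  have h₁ : resultant (linear₁ a₁) (qBi a₁ a₂) =
      resultant (linear₁ a₁) (qBi a₁ a₂) 1 2 := by
    rw [h.natDegree_qBi, h.natDegree_linear₁]
  rw [h₁, hq, resultant_add_mul_right _ _ _ _ _ (by omega) h.natDegree_linear₁.le,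
    resultant_C_right, pow_one]
  have hc : (linear₁ a₁).coeff 1 = C (a₁.F ⬝ᵥ a₁.e) := by simp [linear₁]
  rw [hc, mul_neg]
  refine (Associated.neg_left ?_)
  exact associated_unit_mul_left _ _
    ((isUnit_C.2 (isUnit_iff_ne_zero.2 h.left_ne)).pow 2)

theorem associated_u₁_mul :
    Associated (u₁ a₁ a₂ * linear₂ a₂) (u₂ a₁ a₂ * cofactor₂ a₁ a₂) := by
  have hu := h.isUnit_leadingCoeff_qBi
  have h₁ := associated_resultant_of_dvd_sub hu h.qBi_dvd
  have h₂ := (associated_resultant_mul hu).symm.trans (h₁.trans (associated_resultant_mul hu))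
  have h₃ : resultant (C (linear₂ a₂)) (qBi a₁ a₂) = linear₂ a₂ * linear₂ a₂ := by
    rw [natDegree_C, h.natDegree_qBi, resultant_C_zero_left, pow_two]
  rw [h₃] at h₂
  have h₄ := h₂.trans ((Associated.refl (u₂ a₁ a₂)).mul_mul h.associated_resultant_linear₁)
  refine Associated.of_mul_right (b := linear₂ a₂) (d := linear₂ a₂) ?_ (Associated.refl _)
    h.linear₂_ne_zero
  rw [mul_assoc, mul_assoc, mul_comm (cofactor₂ a₁ a₂)]
  exact h₄

theorem isCoprime_linear₂_cofactor₂ : IsCoprime (linear₂ a₂) (cofactor₂ a₁ a₂) := by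
  refine ⟨C (-(a₂.e ⬝ᵥ a₁.D) *
    ((a₂.F ⬝ᵥ a₂.e) * (a₂.q ⬝ᵥ a₁.D) - (a₂.G ⬝ᵥ a₂.e) * (a₂.e ⬝ᵥ a₁.D))⁻¹),
    C ((a₂.F ⬝ᵥ a₂.e) *
    ((a₂.F ⬝ᵥ a₂.e) * (a₂.q ⬝ᵥ a₁.D) - (a₂.G ⬝ᵥ a₂.e) * (a₂.e ⬝ᵥ a₁.D))⁻¹), ?_⟩
  have hl := congrArg (C : ℝ → ℝ[X]) (mul_inv_cancel₀ h.linear_ne)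
  unfold linear₂ cofactor₂
  generalize ((a₂.F ⬝ᵥ a₂.e) * (a₂.q ⬝ᵥ a₁.D) - (a₂.G ⬝ᵥ a₂.e) * (a₂.e ⬝ᵥ a₁.D))⁻¹ = w at hl ⊢
  simp only [map_mul, map_sub, map_neg, map_one] at hl ⊢
  linear_combination hl

/-- Coprimality turns `associated_u₁_mul` into 𝔲₂ = ℓ₂ v and 𝔲₁ = v m up to a unit, where ℓ₂ and m
are `linear₂` and `cofactor₂`; the gcd is then v. -/
theorem associated_linear₂_mul_u : Associated (u₂ a₁ a₂) (linear₂ a₂ * u a₁ a₂) := by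
  have h₁ := h.associated_u₁_mul
  have hcop := h.isCoprime_linear₂_cofactor₂
  obtain ⟨v, hv⟩ : linear₂ a₂ ∣ u₂ a₁ a₂ :=
    hcop.dvd_of_dvd_mul_right ((Dvd.intro_left _ rfl).trans h₁.dvd)
  have h₂ : Associated (u₁ a₁ a₂) (v * cofactor₂ a₁ a₂) := by
    refine Associated.of_mul_right (b := linear₂ a₂) (d := linear₂ a₂) ?_ (Associated.refl _)
      h.linear₂_ne_zero
    rw [show v * cofactor₂ a₁ a₂ * linear₂ a₂ = u₂ a₁ a₂ * cofactor₂ a₁ a₂ by rw [hv]; ring]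
    exact h₁
  have h₃ : v ∣ u a₁ a₂ :=
    EuclideanDomain.dvd_gcd ((Dvd.intro _ rfl).trans h₂.symm.dvd) (hv ▸ Dvd.intro_left _ rfl)
  have h₄ : u a₁ a₂ ∣ v := by
    obtain ⟨x, y, hxy⟩ := hcop
    have e : v = x * u₂ a₁ a₂ + y * (v * cofactor₂ a₁ a₂) := by
      rw [hv]; linear_combination (-v) * hxy
    rw [e]
    exact dvd_add ((EuclideanDomain.gcd_dvd_right _ _).mul_left _)
      (((EuclideanDomain.gcd_dvd_left _ _).trans h₂.dvd).mul_left _)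
  rw [hv]
  exact (associated_of_dvd_dvd h₃ h₄).mul_left _

theorem associated_formalU₂_mul : Associated (formalU₂ a₁ a₂) (linear₂ a₂ * u a₁ a₂) :=
  h.associated_formalU₂.trans h.associated_linear₂_mul_u

theorem separable_linear₂_mul_u : (linear₂ a₂ * u a₁ a₂).Separable :=
  h.separable_formalU₂.of_dvd h.associated_formalU₂_mul.symm.dvd

theorem natDegree_u : (u a₁ a₂).natDegree = 9 := by
  have h₁ := natDegree_eq_of_degree_eq (degree_eq_degree_of_associated h.associated_formalU₂_mul)
  have h0 : linear₂ a₂ * u a₁ a₂ ≠ 0 := h.separable_linear₂_mul_u.ne_zero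
  rw [h.natDegree_formalU₂, natDegree_mul (left_ne_zero_of_mul h0) (right_ne_zero_of_mul h0),
    h.natDegree_linear₂] at h₁
  omega

end IsGeneric

variable {a₁ a₂}

/-- The hypotheses say that the generators of the ideal vanish at the given point. -/
theorem keplerIdeal_le_ker {R : Type*} [CommRing R] [Algebra ℝ R]
    (φ : MvPolynomial Unknown ℝ →ₐ[ℝ] R)
    (hc : angMom a₁ (φ (.X .rho₁)) (φ (.X .rhoDot₁)) = angMom a₂ (φ (.X .rho₂)) (φ (.X .rhoDot₂)))
    (hL : muLenz a₁ (φ (.X .rho₁)) (φ (.X .rhoDot₁)) (φ (.X .z₁)) =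
      muLenz a₂ (φ (.X .rho₂)) (φ (.X .rhoDot₂)) (φ (.X .z₂)))
    (hE : energy a₁ (φ (.X .rho₁)) (φ (.X .rhoDot₁)) (φ (.X .z₁)) =
      energy a₂ (φ (.X .rho₂)) (φ (.X .rhoDot₂)) (φ (.X .z₂))) :
    keplerIdeal a₁ a₂ ≤ RingHom.ker φ := by
  refine Ideal.span_le.2 ?_
  rintro _ ((⟨i, rfl⟩ | ⟨i, rfl⟩) | rfl)
  · have : φ ∘ angMomDiff a₁ a₂ = 0 := by
      rw [angMomDiff, comp_sub, comp_angMom, comp_angMom, hc, sub_self]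
    exact congrFun this i
  · have : φ ∘ muLenzDiff a₁ a₂ = 0 := by
      rw [muLenzDiff, comp_sub, comp_muLenz, comp_muLenz, hL, sub_self]
    exact congrFun this i
  · change φ (energyDiff a₁ a₂) = 0
    rw [energyDiff, map_sub, map_energy, map_energy, hE, sub_self]

/-! ### Membership in the ideal and minimality of the degree. -/

namespace IsGeneric

variable (h : IsGeneric a₁ a₂)
include h

theorem aeval_u₁_eq_zero {R : Type*} [CommRing R] [Algebra ℝ R] {ρ₁ ρ₂ : R}
    (hq : biEval ρ₁ ρ₂ (qBi a₁ a₂) = 0) (hp : biEval ρ₁ ρ₂ (p₁ a₁ a₂) = 0) :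
    aeval ρ₂ (u₁ a₁ a₂) = 0 := by
  obtain ⟨s, t, -, -, e⟩ := exists_mul_add_mul_eq_C_resultant (p₁ a₁ a₂) (qBi a₁ a₂) le_rfl le_rfl
    (Or.inr (by rw [h.natDegree_qBi]; norm_num))
  rw [← biEval_C ρ₁, u₁, ← e, map_add, map_mul, map_mul, hq, hp, zero_mul, zero_mul, add_zero]

theorem aeval_u₂_eq_zero {R : Type*} [CommRing R] [Algebra ℝ R] {ρ₁ ρ₂ : R}
    (hq : biEval ρ₁ ρ₂ (qBi a₁ a₂) = 0) (hp : biEval ρ₁ ρ₂ (p₂ a₁ a₂) = 0) :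
    aeval ρ₂ (u₂ a₁ a₂) = 0 := by
  obtain ⟨s, t, -, -, e⟩ := exists_mul_add_mul_eq_C_resultant (p₂ a₁ a₂) (qBi a₁ a₂) le_rfl le_rfl
    (Or.inr (by rw [h.natDegree_qBi]; norm_num))
  rw [← biEval_C ρ₁, u₂, ← e, map_add, map_mul, map_mul, hq, hp, zero_mul, zero_mul, add_zero]

/-- In the quotient by the ideal the classes of the unknowns solve all the equations, so q, p₁ and
p₂ vanish there; a Bézout relation for the gcd finishes. -/
theorem inRho₂_u_mem : inRho₂ (u a₁ a₂) ∈ keplerIdeal a₁ a₂ := by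
  rw [← Ideal.Quotient.eq_zero_iff_mem]
  let φ : MvPolynomial Unknown ℝ →ₐ[ℝ] MvPolynomial Unknown ℝ ⧸ keplerIdeal a₁ a₂ :=
    Ideal.Quotient.mkₐ ℝ (keplerIdeal a₁ a₂)
  have hφ : ∀ f ∈ (Set.range (angMomDiff a₁ a₂) ∪ Set.range (muLenzDiff a₁ a₂) ∪
      {energyDiff a₁ a₂} : Set (MvPolynomial Unknown ℝ)), φ f = 0 := fun f hf =>
    Ideal.Quotient.eq_zero_iff_mem.2 (Ideal.subset_span hf)
  have hc : angMom a₁ (φ (.X .rho₁)) (φ (.X .rhoDot₁)) =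
      angMom a₂ (φ (.X .rho₂)) (φ (.X .rhoDot₂)) := by
    rw [← sub_eq_zero, ← comp_angMom, ← comp_angMom, ← comp_sub]
    exact funext fun i => hφ _ (Or.inl (Or.inl ⟨i, rfl⟩))
  have hL : muLenz a₁ (φ (.X .rho₁)) (φ (.X .rhoDot₁)) (φ (.X .z₁)) -
      muLenz a₂ (φ (.X .rho₂)) (φ (.X .rhoDot₂)) (φ (.X .z₂)) = 0 := by
    rw [← comp_muLenz, ← comp_muLenz, ← comp_sub]
    exact funext fun i => hφ _ (Or.inl (Or.inr ⟨i, rfl⟩))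
  have hE : energy a₁ (φ (.X .rho₁)) (φ (.X .rhoDot₁)) (φ (.X .z₁)) =
      energy a₂ (φ (.X .rho₂)) (φ (.X .rhoDot₂)) (φ (.X .z₂)) := by
    rw [← sub_eq_zero, ← map_energy, ← map_energy, ← map_sub]
    exact hφ _ (Or.inr rfl)
  have hxi : xi a₁ a₂ (φ (.X .rho₁)) (φ (.X .rho₂)) (φ (.X .rhoDot₁)) (φ (.X .rhoDot₂)) = 0 := by
    rw [xi_eq _ _ _ _ _ _ (φ (.X .z₁)) (φ (.X .z₂)), hL, hE, ← smul_sub, zero_sub,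
      map_neg, map_smul, LinearMap.neg_apply, LinearMap.smul_apply, cross_self, smul_zero, neg_zero]
  have hq := biEval_qBi (φ (.X .rho₁)) (φ (.X .rho₂)) a₁ a₂
  rw [qPoly_eq_zero_of_angMom_eq hc] at hq
  have hp₁ := biEval_p₁ (φ (.X .rho₁)) (φ (.X .rho₂)) a₁ a₂
  have hp₂ := biEval_p₂ (φ (.X .rho₁)) (φ (.X .rho₂)) a₁ a₂
  rw [rhoDot₁_eq_of_angMom_eq h.normSqD_ne hc, rhoDot₂_eq_of_angMom_eq h.normSqD_ne hc, hxi,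
    zero_dotProduct] at hp₁ hp₂
  change φ (inRho₂ (u a₁ a₂)) = 0
  rw [inRho₂, ← aeval_algHom_apply, u, EuclideanDomain.gcd_eq_gcd_ab, map_add, map_mul, map_mul,
    h.aeval_u₁_eq_zero hq hp₁, h.aeval_u₂_eq_zero hq hp₂, zero_mul, zero_mul, add_zero]

/-- The leading coefficient of q in ρ₁ is constant, so q keeps degree 2 after specialization and a
vanishing resultant means a genuine common root. -/
theorem exists_common_zero {s : ℂ} (hs : aeval s (formalU₂ a₁ a₂) = 0) :
    ∃ t : ℂ, biEval t s (qBi a₁ a₂) = 0 ∧ biEval t s (p₂ a₁ a₂) = 0 := by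
  set ψ : ℝ[X] →+* ℂ := (aeval s : ℝ[X] →ₐ[ℝ] ℂ).toRingHom with hψ
  have hu : IsUnit (ψ (qBi a₁ a₂).leadingCoeff) := h.isUnit_leadingCoeff_qBi.map ψ
  have hd : ((qBi a₁ a₂).map ψ).natDegree = 2 := by
    rw [natDegree_map_of_leadingCoeff_ne_zero ψ hu.ne_zero, h.natDegree_qBi]
  have hl : IsUnit ((qBi a₁ a₂).map ψ).leadingCoeff := by
    rw [leadingCoeff_map_of_leadingCoeff_ne_zero ψ hu.ne_zero]
    exact hu
  have hm : ((p₂ a₁ a₂).map ψ).natDegree ≤ 5 :=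
    natDegree_map_le.trans (totalDegreeLE_p₂ a₁ a₂).natDegree_le
  have hr := associated_resultant hd hl hm
  rw [resultant_map_map] at hr
  change ψ (formalU₂ a₁ a₂) = 0 at hs
  have h0 : ψ (resultant (p₂ a₁ a₂) (qBi a₁ a₂) 5 2) = 0 := hs
  rw [h0, Associated.comm, associated_zero_iff_eq_zero, resultant_eq_zero_iff,
    isCoprime_iff_aeval_ne_zero_of_isAlgClosed ℂ ℂ] at hr
  obtain ⟨t, ht⟩ := not_forall.1 hr.2
  rw [not_or, not_not, not_not] at ht
  refine ⟨t, ?_, ?_⟩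
  · rw [biEval_apply, ← hψ, ← eval_map]
    simpa using ht.2
  · rw [biEval_apply, ← hψ, ← eval_map]
    simpa using ht.1

theorem aeval_eq_zero_of_mem {p : ℝ[X]} (hp : inRho₂ p ∈ keplerIdeal a₁ a₂) {s : ℂ}
    (hs : aeval s (u a₁ a₂) = 0) : aeval s p = 0 := by
  have hU : aeval s (formalU₂ a₁ a₂) = 0 := by
    obtain ⟨k, hk⟩ := h.associated_formalU₂_mul.symm.dvd
    rw [hk, map_mul, map_mul, hs, mul_zero, zero_mul]
  obtain ⟨t, hq, hp₂⟩ := h.exists_common_zero hU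
  -- Separability of the product forbids a common root of its two factors.
  have hl : aeval s (linear₂ a₂) ≠ 0 := by
    have hcop := h.separable_linear₂_mul_u.isCoprime
    exact (aeval_ne_zero_of_isCoprime hcop s).resolve_right (fun hn => hn hs)
  rw [biEval_qBi] at hq
  have hp₁ : biEval t s (p₁ a₁ a₂) = 0 := by
    have e := biEval_p₁_mul t s a₁ a₂ h.normSqD_ne hq
    rw [map_mul, map_mul, hp₂, zero_mul, biEval_C] at e
    exact (mul_eq_zero.1 e).resolve_right hl
  rw [biEval_p₁] at hp₁
  rw [biEval_p₂] at hp₂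
  obtain ⟨z₁, z₂, hE, hL⟩ := exists_energy_eq_muLenz_eq h.triple_ne
    (xi_eq_zero h.triple_ne hp₁ hp₂)
  have hker := keplerIdeal_le_ker (a₁ := a₁) (a₂ := a₂)
    (MvPolynomial.aeval (fun x : Unknown => match x with
      | .rho₁ => t
      | .rho₂ => s
      | .rhoDot₁ => rhoDot₁ a₁ a₂ t s
      | .rhoDot₂ => rhoDot₂ a₁ a₂ t s
      | .z₁ => z₁
      | .z₂ => z₂))
    (by simpa using angMom_eq_of_qPoly_eq_zero h.normSqD_ne hq) (by simpa using hL)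
    (by simpa using hE)
  have := hker hp
  rw [RingHom.mem_ker, inRho₂] at this
  change MvPolynomial.aeval _ _ = 0 at this
  rw [← aeval_algHom_apply, MvPolynomial.aeval_X] at this
  exact this

theorem natDegree_u_le {p : ℝ[X]} (h0 : p ≠ 0) (hp : inRho₂ p ∈ keplerIdeal a₁ a₂) :
    (u a₁ a₂).natDegree ≤ p.natDegree := by
  have hsep : (u a₁ a₂).Separable :=
    h.separable_linear₂_mul_u.of_dvd (Dvd.intro_left _ rfl)
  rw [← card_rootSet_eq_natDegree (K := ℂ) hsep (IsAlgClosed.splits _), ← Nat.card_eq_fintype_card]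
  refine le_trans ?_ (ncard_rootSet_le p ℂ)
  refine Set.ncard_le_ncard (fun s hs => ?_) (rootSet_finite _ _)
  rw [mem_rootSet] at hs ⊢
  exact ⟨h0, h.aeval_eq_zero_of_mem hp hs.2⟩

end IsGeneric

/-! ### Polynomials whose coefficients vary in a ring of functions. -/

section Families

variable {ι S : Type*} [CommRing S]

/-- The families of polynomials all of whose coefficients belong to `A`. -/
def coeffFamilies (A : Subring (ι → S)) : Subring (ι → S[X]) where
  carrier := {F | ∀ j, (fun x => (F x).coeff j) ∈ A}
  mul_mem' {F G} hF hG j := by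
    have : (fun x => ((F * G) x).coeff j) = ∑ y ∈ Finset.HasAntidiagonal.antidiagonal j,
        (fun x => (F x).coeff y.1) * (fun x => (G x).coeff y.2) := by
      ext x
      simp [coeff_mul]
    rw [this]
    exact A.sum_mem fun y _ => A.mul_mem (hF _) (hG _)
  one_mem' j := by
    by_cases hj : j = 0
    · simp only [Pi.one_apply, coeff_one, hj, if_true]
      exact A.one_mem
    · simp only [Pi.one_apply, coeff_one, hj, if_false]
      exact A.zero_mem
  add_mem' {F G} hF hG j := by
    have : (fun x => ((F + G) x).coeff j) =
        (fun x => (F x).coeff j) + (fun x => (G x).coeff j) := by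
      ext x
      simp
    rw [this]
    exact A.add_mem (hF j) (hG j)
  zero_mem' _ := A.zero_mem
  neg_mem' {F} hF j := by
    have : (fun x => ((-F) x).coeff j) = -(fun x => (F x).coeff j) := by
      ext x
      simp
    rw [this]
    exact A.neg_mem (hF j)

variable {A : Subring (ι → S)}

theorem fun_add_mem {f g : ι → S} (hf : f ∈ A) (hg : g ∈ A) : (fun x => f x + g x) ∈ A :=
  A.add_mem hf hg

theorem fun_sub_mem {f g : ι → S} (hf : f ∈ A) (hg : g ∈ A) : (fun x => f x - g x) ∈ A :=
  A.sub_mem hf hg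

theorem fun_mul_mem {f g : ι → S} (hf : f ∈ A) (hg : g ∈ A) : (fun x => f x * g x) ∈ A :=
  A.mul_mem hf hg

theorem fun_C_mem {f : ι → S} (hf : f ∈ A) : (fun x => C (f x)) ∈ coeffFamilies A := fun j => by
  rcases Nat.eq_zero_or_pos j with rfl | hj
  · simpa using hf
  · simp only [coeff_C_of_ne_zero hj.ne']
    exact A.zero_mem

theorem fun_X_mem : (fun _ => X) ∈ coeffFamilies A := fun j => by
  by_cases hj : j = 1
  · simp only [coeff_X, hj, if_true]
    exact A.one_mem
  · simp only [coeff_X, Ne.symm hj, if_false]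
    exact A.zero_mem

theorem fun_derivative_mem {F : ι → S[X]} (hF : F ∈ coeffFamilies A) :
    (fun x => derivative (F x)) ∈ coeffFamilies A := fun j => by
  simp only [coeff_derivative]
  refine fun_mul_mem (hF _) ?_
  exact_mod_cast natCast_mem A (j + 1)

/-- The formal degrees must not depend on the parameter: then the Sylvester matrix has fixed size
and its determinant is a fixed polynomial in the coefficients. -/
theorem fun_resultant_mem {F G : ι → S[X]} (hF : F ∈ coeffFamilies A) (hG : G ∈ coeffFamilies A)
    (m n : ℕ) : (fun x => resultant (F x) (G x) m n) ∈ A := by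
  have hs : ∀ i j, (fun x => sylvester (F x) (G x) m n i j) ∈ A := by
    intro i j
    refine j.addCases (fun j => ?_) (fun j => ?_)
    · simp only [sylvester, Matrix.of_apply, Fin.addCases_left]
      split_ifs
      · exact hG _
      · exact A.zero_mem
    · simp only [sylvester, Matrix.of_apply, Fin.addCases_right]
      split_ifs
      · exact hF _
      · exact A.zero_mem
  have : (fun x => resultant (F x) (G x) m n) = ∑ σ : Equiv.Perm (Fin (m + n)),
      (Equiv.Perm.sign σ : ℤ) • ∏ i, (fun x => sylvester (F x) (G x) m n (σ i) i) := by
    ext x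
    simp [resultant, Matrix.det_apply, Units.smul_def]
  rw [this]
  exact A.sum_mem fun σ _ => A.zsmul_mem (A.prod_mem fun i _ => hs _ _) _

/-- A family of vectors has its entries in `A`. -/
def VecFamily (A : Subring (ι → S)) (v : ι → Fin 3 → S) : Prop := ∀ i, (fun x => v x i) ∈ A

namespace VecFamily

variable {v w : ι → Fin 3 → S} {r : ι → S}

theorem add (hv : VecFamily A v) (hw : VecFamily A w) : VecFamily A (fun x => v x + w x) :=
  fun i => fun_add_mem (hv i) (hw i)

theorem sub (hv : VecFamily A v) (hw : VecFamily A w) : VecFamily A (fun x => v x - w x) :=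
  fun i => fun_sub_mem (hv i) (hw i)

theorem smul (hr : r ∈ A) (hv : VecFamily A v) : VecFamily A (fun x => r x • v x) :=
  fun i => fun_mul_mem hr (hv i)

theorem dotProduct (hv : VecFamily A v) (hw : VecFamily A w) : (fun x => v x ⬝ᵥ w x) ∈ A := by
  simp only [_root_.dotProduct, Fin.sum_univ_three]
  exact fun_add_mem (fun_add_mem (fun_mul_mem (hv 0) (hw 0)) (fun_mul_mem (hv 1) (hw 1)))
    (fun_mul_mem (hv 2) (hw 2))

theorem cross (hv : VecFamily A v) (hw : VecFamily A w) : VecFamily A (fun x => v x ⨯₃ w x) := by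
  have h : ∀ i j k l, (fun x => v x i * w x j - v x k * w x l) ∈ A := fun i j k l =>
    fun_sub_mem (fun_mul_mem (hv i) (hw j)) (fun_mul_mem (hv k) (hw l))
  intro i
  fin_cases i <;> simp only [cross_apply] <;> exact h _ _ _ _

end VecFamily

end Families

/-! ### Dependence of q and p₂ on the data. -/

section KeplerFamilies

variable {ι : Type*} {A : Subring (ι → ℝ)} {a₁ a₂ : ι → ArcData}

/-- The unit vectors and the observer data of a family of arcs have entries in `A`. -/
structure ArcFamily (A : Subring (ι → ℝ)) (a : ι → ArcData) : Prop where
  q : VecFamily A (fun x => (a x).q)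
  qDot : VecFamily A (fun x => (a x).qDot)
  e : VecFamily A (fun x => (a x).e)
  ePerp : VecFamily A (fun x => (a x).ePerp)

namespace ArcFamily

variable {a : ι → ArcData} (h : ArcFamily A a)
include h

theorem D : VecFamily A (fun x => (a x).D) := h.q.cross h.e

theorem E : VecFamily A (fun x => (a x).E) := h.e.cross h.ePerp

theorem F : VecFamily A (fun x => (a x).F) := (h.q.cross h.ePerp).add (h.e.cross h.qDot)

theorem G : VecFamily A (fun x => (a x).G) := h.q.cross h.qDot

end ArcFamily

theorem algebraMap_mem {f : ι → ℝ} (hf : f ∈ A) :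
    (fun x => algebraMap ℝ ℝ[X][X] (f x)) ∈ coeffFamilies (coeffFamilies A) := by
  simpa [Polynomial.algebraMap_apply] using fun_C_mem (fun_C_mem hf)

theorem VecFamily.const {v : ι → Fin 3 → ℝ} (hv : VecFamily A v) :
    VecFamily (coeffFamilies (coeffFamilies A)) (fun x => const ℝ[X][X] (v x)) :=
  fun i => algebraMap_mem (hv i)

theorem biRho₁_mem : (fun _ => biRho₁) ∈ coeffFamilies (coeffFamilies A) := fun_X_mem

theorem biRho₂_mem : (fun _ => biRho₂) ∈ coeffFamilies (coeffFamilies A) := fun_C_mem fun_X_mem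

variable (h₁ : ArcFamily A a₁) (h₂ : ArcFamily A a₂)
include h₁ h₂

theorem vecFamily_J : VecFamily (coeffFamilies (coeffFamilies A))
    (fun x => J (a₁ x) (a₂ x) biRho₁ biRho₂) := by
  simp only [J, pow_two]
  exact (((((VecFamily.smul (fun_mul_mem biRho₂_mem biRho₂_mem) h₂.E.const).sub
    (VecFamily.smul (fun_mul_mem biRho₁_mem biRho₁_mem) h₁.E.const)).add
    (VecFamily.smul biRho₂_mem h₂.F.const)).sub
    (VecFamily.smul biRho₁_mem h₁.F.const)).add h₂.G.const).sub h₁.G.const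

theorem qBi_mem : (fun x => qBi (a₁ x) (a₂ x)) ∈ coeffFamilies (coeffFamilies A) :=
  (vecFamily_J h₁ h₂).dotProduct (h₁.D.cross h₂.D).const

theorem p₂_mem (hinv : (fun x => (normSqD (a₁ x) (a₂ x))⁻¹) ∈ A)
    (hconst : ∀ r : ℝ, (fun _ => r) ∈ A) :
    (fun x => p₂ (a₁ x) (a₂ x)) ∈ coeffFamilies (coeffFamilies A) := by
  have hN := h₁.D.cross h₂.D
  have hJ := vecFamily_J h₁ h₂
  have hd₁ : (fun x => rhoDot₁ (a₁ x) (a₂ x) biRho₁ biRho₂) ∈ coeffFamilies (coeffFamilies A) :=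
    fun_mul_mem (algebraMap_mem hinv) (hJ.dotProduct (h₂.D.cross hN).const)
  have hd₂ : (fun x => rhoDot₂ (a₁ x) (a₂ x) biRho₁ biRho₂) ∈ coeffFamilies (coeffFamilies A) :=
    fun_mul_mem (algebraMap_mem hinv) (hJ.dotProduct (h₁.D.cross hN).const)
  have hr₁ : VecFamily (coeffFamilies (coeffFamilies A)) (fun x => pos (a₁ x) biRho₁) :=
    h₁.q.const.add (VecFamily.smul biRho₁_mem h₁.e.const)
  have hr₂ : VecFamily (coeffFamilies (coeffFamilies A)) (fun x => pos (a₂ x) biRho₂) :=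
    h₂.q.const.add (VecFamily.smul biRho₂_mem h₂.e.const)
  have hv₁ : VecFamily (coeffFamilies (coeffFamilies A))
      (fun x => vel (a₁ x) biRho₁ (rhoDot₁ (a₁ x) (a₂ x) biRho₁ biRho₂)) :=
    (h₁.qDot.const.add (VecFamily.smul hd₁ h₁.e.const)).add
      (VecFamily.smul biRho₁_mem h₁.ePerp.const)
  have hv₂ : VecFamily (coeffFamilies (coeffFamilies A))
      (fun x => vel (a₂ x) biRho₂ (rhoDot₂ (a₁ x) (a₂ x) biRho₁ biRho₂)) :=
    (h₂.qDot.const.add (VecFamily.smul hd₂ h₂.e.const)).add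
      (VecFamily.smul biRho₂_mem h₂.ePerp.const)
  refine VecFamily.dotProduct (VecFamily.add (VecFamily.sub ?_ ?_) ?_) h₂.e.const
  · exact VecFamily.smul (fun_mul_mem (algebraMap_mem (hconst _))
      (fun_sub_mem (hv₂.dotProduct hv₂) (hv₁.dotProduct hv₁))) (hr₁.cross hr₂)
  · exact VecFamily.smul (hv₁.dotProduct hr₁) (hv₁.cross (hr₁.sub hr₂))
  · exact VecFamily.smul (hv₂.dotProduct hr₂) (hv₂.cross (hr₁.sub hr₂))

end KeplerFamilies

/-! ### Open dense nonvanishing by the identity theorem. -/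

section Analytic

variable {V : Type*} [NormedAddCommGroup V] [NormedSpace ℝ V]

/-- The functions that become analytic after multiplication by a power of `n`, where `n ≠ 0`. -/
def regularFunctions (n : V → ℝ) (hn : AnalyticOnNhd ℝ n Set.univ) : Subring (V → ℝ) where
  carrier := {f | ∃ (k : ℕ) (g : V → ℝ), AnalyticOnNhd ℝ g Set.univ ∧
    ∀ x, n x ≠ 0 → n x ^ k * f x = g x}
  mul_mem' := by
    rintro f f' ⟨k, g, hg, h⟩ ⟨k', g', hg', h'⟩
    refine ⟨k + k', g * g', hg.mul hg', fun x hx => ?_⟩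
    rw [Pi.mul_apply, Pi.mul_apply, ← h x hx, ← h' x hx]
    ring
  one_mem' := ⟨0, 1, analyticOnNhd_const, by simp⟩
  add_mem' := by
    rintro f f' ⟨k, g, hg, h⟩ ⟨k', g', hg', h'⟩
    refine ⟨k + k', n ^ k' * g + n ^ k * g', ((hn.pow k').mul hg).add ((hn.pow k).mul hg'),
      fun x hx => ?_⟩
    simp only [Pi.add_apply, Pi.mul_apply, Pi.pow_apply, ← h x hx, ← h' x hx]
    ring
  zero_mem' := ⟨0, 0, analyticOnNhd_const, by simp⟩
  neg_mem' := by
    rintro f ⟨k, g, hg, h⟩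
    refine ⟨k, -g, hg.neg, fun x hx => ?_⟩
    rw [Pi.neg_apply, Pi.neg_apply, ← h x hx]
    ring

variable {n : V → ℝ} (hn : AnalyticOnNhd ℝ n Set.univ)

theorem mem_regularFunctions {g : V → ℝ} (hg : AnalyticOnNhd ℝ g Set.univ) :
    g ∈ regularFunctions n hn := ⟨0, g, hg, by simp⟩

theorem inv_mem_regularFunctions : (fun x => (n x)⁻¹) ∈ regularFunctions n hn :=
  ⟨1, 1, analyticOnNhd_const, fun x hx => by simp [hx]⟩

theorem isOpen_dense_of_mem_regularFunctions {f : V → ℝ} (hf : f ∈ regularFunctions n hn) {w : V}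
    (hnw : n w ≠ 0) (hfw : f w ≠ 0) :
    IsOpen {x | n x ≠ 0 ∧ f x ≠ 0} ∧ Dense {x | n x ≠ 0 ∧ f x ≠ 0} := by
  obtain ⟨k, g, hg, h⟩ := hf
  -- Where n ≠ 0, f and g = nᵏ f have the same zeros; the factor n removes the locus where f is
  -- uncontrolled.
  have hset : {x | n x ≠ 0 ∧ f x ≠ 0} = {x | (n * g) x ≠ 0} := by
    ext x
    simp only [Set.mem_ofPred_eq, Pi.mul_apply, mul_ne_zero_iff]
    refine and_congr_right fun hx => ?_
    rw [← h x hx, mul_ne_zero_iff, and_iff_right (pow_ne_zero k hx)]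
  have hng : AnalyticOnNhd ℝ (n * g) Set.univ := hn.mul hg
  rw [hset, show {x | (n * g) x ≠ 0} = {x | (n * g) x = 0}ᶜ from rfl]
  constructor
  · exact isOpen_ne_fun (continuousOn_univ.1 hng.continuousOn) continuous_const
  · refine interior_eq_empty_iff_dense_compl.1 (Set.eq_empty_iff_forall_notMem.2 fun x hx => ?_)
    have hx' : (n * g) =ᶠ[nhds x] 0 := by
      filter_upwards [mem_interior_iff_mem_nhds.1 hx] with y hy
      exact hy
    have h0 := hng.eq_of_eventuallyEq analyticOnNhd_const hx'
    have hw : (n * g) w ≠ 0 := by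
      rw [Pi.mul_apply, ← h w hnw]
      exact mul_ne_zero hnw (mul_ne_zero (pow_ne_zero k hnw) hfw)
    exact hw (congrFun h0 w)

end Analytic

/-! ### An explicit generic pair of arcs. -/

/-- The first arc of an explicit generic pair. -/
def sampleArc₁ : ArcData := ((0, 0, 1, 0), ![0, 0, 1], ![-1, 0, 1])

/-- The second arc of an explicit generic pair. -/
def sampleArc₂ : ArcData := ((Real.pi / 2, 0, 1, -1), ![0, -1, -1], ![-1, 0, -1])

theorem sampleArc₁_q : ArcData.q sampleArc₁ = ![0, 0, 1] := rfl
theorem sampleArc₁_qDot : ArcData.qDot sampleArc₁ = ![-1, 0, 1] := rfl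
theorem sampleArc₂_q : ArcData.q sampleArc₂ = ![0, -1, -1] := rfl
theorem sampleArc₂_qDot : ArcData.qDot sampleArc₂ = ![-1, 0, -1] := rfl

theorem sampleArc₁_e : ArcData.e sampleArc₁ = ![1, 0, 0] := by
  simp [ArcData.e, ArcData.ra, ArcData.dec, sampleArc₁, eRho]

theorem sampleArc₂_e : ArcData.e sampleArc₂ = ![0, 1, 0] := by
  simp [ArcData.e, ArcData.ra, ArcData.dec, sampleArc₂, eRho]

theorem sampleArc₁_ePerp : ArcData.ePerp sampleArc₁ = ![0, 1, 0] := by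
  simp [ArcData.ePerp, ArcData.ra, ArcData.dec, ArcData.raDot, ArcData.decDot, sampleArc₁, eAlpha,
    eDelta]

theorem sampleArc₂_ePerp : ArcData.ePerp sampleArc₂ = ![-1, 0, -1] := by
  simp [ArcData.ePerp, ArcData.ra, ArcData.dec, ArcData.raDot, ArcData.decDot, sampleArc₂, eAlpha,
    eDelta]

theorem sampleArc₁_D : ArcData.D sampleArc₁ = ![0, 1, 0] := by
  simp [ArcData.D, sampleArc₁_q, sampleArc₁_e, cross_apply]

theorem sampleArc₂_D : ArcData.D sampleArc₂ = ![1, 0, 0] := by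
  simp [ArcData.D, sampleArc₂_q, sampleArc₂_e, cross_apply]

theorem sampleArc₁_E : ArcData.E sampleArc₁ = ![0, 0, 1] := by
  simp [ArcData.E, sampleArc₁_e, sampleArc₁_ePerp, cross_apply]

theorem sampleArc₂_E : ArcData.E sampleArc₂ = ![-1, 0, 1] := by
  simp [ArcData.E, sampleArc₂_e, sampleArc₂_ePerp, cross_apply]

theorem sampleArc₁_F : ArcData.F sampleArc₁ = ![-1, -1, 0] := by
  simp [ArcData.F, sampleArc₁_q, sampleArc₁_e, sampleArc₁_qDot, sampleArc₁_ePerp, cross_apply]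

theorem sampleArc₂_F : ArcData.F sampleArc₂ = ![0, 1, 0] := by
  simp [ArcData.F, sampleArc₂_q, sampleArc₂_e, sampleArc₂_qDot, sampleArc₂_ePerp, cross_apply]

theorem sampleArc₁_G : ArcData.G sampleArc₁ = ![0, -1, 0] := by
  simp [ArcData.G, sampleArc₁_q, sampleArc₁_qDot, cross_apply]

theorem sampleArc₂_G : ArcData.G sampleArc₂ = ![1, 1, -1] := by
  simp [ArcData.G, sampleArc₂_q, sampleArc₂_qDot, cross_apply]

/-- The vectors D₁, D₂ are coordinate vectors, so no denominators enter the radial velocities and q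
becomes ρ₁² + 1 - ρ₂². -/
theorem sample_normal : ArcData.D sampleArc₁ ⨯₃ ArcData.D sampleArc₂ = ![0, 0, -1] := by
  simp [sampleArc₁_D, sampleArc₂_D, cross_apply]

theorem sample_normSqD : normSqD sampleArc₁ sampleArc₂ = 1 := by
  simp [normSqD, sample_normal]

theorem qBi_sample : qBi sampleArc₁ sampleArc₂ = X ^ 2 + C (1 - X ^ 2) := by
  rw [qBi_eq, sample_normal, sampleArc₁_E, sampleArc₂_E, sampleArc₁_F, sampleArc₂_F, sampleArc₁_G,
    sampleArc₂_G]
  simp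
  ring

theorem rhoDot₁_sample {R : Type*} [CommRing R] [Algebra ℝ R] (ρ₁ ρ₂ : R) :
    rhoDot₁ sampleArc₁ sampleArc₂ ρ₁ ρ₂ = ρ₁ + ρ₂ + 2 := by
  rw [rhoDot₁, sample_normSqD, sample_normal, J]
  simp [sampleArc₁_E, sampleArc₂_E, sampleArc₁_F, sampleArc₂_F, sampleArc₁_G, sampleArc₂_G,
    sampleArc₂_D, cross_apply, const, dotProduct, Fin.sum_univ_three]
  ring

theorem rhoDot₂_sample {R : Type*} [CommRing R] [Algebra ℝ R] (ρ₁ ρ₂ : R) :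
    rhoDot₂ sampleArc₁ sampleArc₂ ρ₁ ρ₂ = ρ₂ ^ 2 - ρ₁ - 1 := by
  rw [rhoDot₂, sample_normSqD, sample_normal, J]
  simp [sampleArc₁_E, sampleArc₂_E, sampleArc₁_F, sampleArc₂_F, sampleArc₁_G, sampleArc₂_G,
    sampleArc₁_D, cross_apply, const, dotProduct, Fin.sum_univ_three]
  ring

/-- Division by q in ρ₁, with a remainder linear in ρ₁; the factor 2 clears the 1/2 in ξ. -/
theorem two_mul_p₂_sample : C 2 * p₂ sampleArc₁ sampleArc₂ =
    C (8 + 8 * X + 4 * X ^ 3 + 4 * X ^ 4) + C (6 + 6 * X + 2 * X ^ 2 - X ^ 4) * X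
      + qBi sampleArc₁ sampleArc₂ * (X + C (4 * X + 4)) := by
  have hh : (2 : ℝ[X][X]) * algebraMap ℝ ℝ[X][X] (1 / 2) = 1 := by
    rw [← map_ofNat (algebraMap ℝ ℝ[X][X]) 2, ← map_mul]
    norm_num
  rw [p₂, xiBi, rhoDot₁_sample, rhoDot₂_sample, xi_dotProduct_e_right, map_ofNat C 2, mul_add,
    mul_sub, ← mul_assoc, ← mul_assoc, hh, one_mul, qBi_sample]
  simp [vel, pos, const, sampleArc₁_q, sampleArc₂_q, sampleArc₁_qDot, sampleArc₂_qDot,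
    sampleArc₁_e, sampleArc₂_e, sampleArc₁_ePerp, sampleArc₂_ePerp, cross_apply, dotProduct,
    Fin.sum_univ_three, biRho₁, biRho₂]
  simp only [map_ofNat]
  ring

theorem resultant_linear_quadratic {S : Type*} [CommRing S] (a b c : S) :
    resultant (C a + C b * X) (X ^ 2 + C c) 1 2 = a ^ 2 + c * b ^ 2 := by
  have h : sylvester (C a + C b * X) (X ^ 2 + C c) 1 2 = !![c, a, 0; 0, b, a; 1, 0, b] := by
    ext i j
    fin_cases i <;> fin_cases j <;> simp [sylvester, Fin.addCases, coeff_X, coeff_C]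
  rw [resultant, h]
  change Matrix.det !![c, a, 0; 0, b, a; 1, 0, b] = _
  rw [Matrix.det_fin_three]
  simp
  ring

theorem formalU₂_sample : C 4 * formalU₂ sampleArc₁ sampleArc₂ =
    100 + 200 * X + 88 * X ^ 2 + 16 * X ^ 3 + 60 * X ^ 4 + 28 * X ^ 5 + 20 * X ^ 6 + 44 * X ^ 7
      + 21 * X ^ 8 - X ^ 10 := by
  have h₁ := resultant_C_mul_left (p₂ sampleArc₁ sampleArc₂) (qBi sampleArc₁ sampleArc₂) 5 2 (2 : ℝ[X])
  have hd : (qBi sampleArc₁ sampleArc₂).natDegree ≤ 2 := by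
    rw [qBi_sample]
    exact (natDegree_X_pow_add_C (n := 2)).le
  have hg : (X + C (4 * X + 4) : ℝ[X][X]).natDegree ≤ 1 := natDegree_X_add_C _ |>.le
  have hl : ∀ a b : ℝ[X], (C a + C b * X).natDegree ≤ 1 := fun a b => by
    rw [add_comm]
    exact natDegree_linear_le
  have hq : (qBi sampleArc₁ sampleArc₂).coeff 2 = 1 := by
    rw [qBi_sample, coeff_add, coeff_X_pow_self, coeff_C_of_ne_zero two_ne_zero, add_zero]
  -- The multiple of q is dropped and the formal degree lowered from 5 to 1, at no cost because q is
  -- monic in ρ₁. Doubling p₂ multiplies the resultant by 2² = 4, as q has degree 2.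
  rw [two_mul_p₂_sample, resultant_add_mul_left _ _ _ _ _ (by omega) hd,
    resultant_add_left_deg _ _ 1 2 4 (hl _ _), hq, qBi_sample, resultant_linear_quadratic] at h₁
  have h₂ : (C 4 : ℝ[X]) = 2 ^ 2 := by
    rw [map_ofNat C 4]
    norm_num
  rw [formalU₂, h₂, qBi_sample, ← h₁]
  ring

theorem separable_formalU₂_sample : (formalU₂ sampleArc₁ sampleArc₂).Separable := by
  refine Separable.of_mul_right (f := C 4) ?_
  rw [formalU₂_sample]
  have hr : (C (1 / 2300280753440000) : ℝ[X]) * 2300280753440000 = 1 := by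
    rw [← map_ofNat C 2300280753440000, ← map_mul]
    norm_num
  -- A Bézout relation between the polynomial and its derivative: the integer combination in
  -- parentheses equals the constant 2300280753440000.
  refine ⟨C (1 / 2300280753440000) * (-394628293689546000 + 26569151013291648 * X
      - 120557711114412412 * X ^ 2 - 358715118286107676 * X ^ 3 + 62804400504805112 * X ^ 4
      - 296197043577882244 * X ^ 5 - 327117757766939768 * X ^ 6 - 22120226630823930 * X ^ 7
      + 20869992987013560 * X ^ 8),
    C (1 / 2300280753440000) * (197325648248540200 + 207697147724184800 * X
      - 22785491809617474 * X ^ 2 + 53208246747192390 * X ^ 3 + 67901996803626040 * X ^ 4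
      - 8913932559304274 * X ^ 5 + 47877599915700073 * X ^ 6 + 41477172831239672 * X ^ 7
      + 2212022663082393 * X ^ 8 - 2086999298701356 * X ^ 9), ?_⟩
  simp only [derivative_add, derivative_sub, derivative_mul, derivative_X_pow, derivative_X,
    derivative_ofNat, map_ofNat, Nat.cast_ofNat]
  linear_combination hr

theorem natDegree_formalU₂_sample : (formalU₂ sampleArc₁ sampleArc₂).natDegree = 10 := by
  rw [← natDegree_C_mul (a := (4 : ℝ)) (by norm_num), formalU₂_sample]
  compute_degree!

theorem isGeneric_sample : IsGeneric sampleArc₁ sampleArc₂ where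
  normSqD_ne := by rw [sample_normSqD]; exact one_ne_zero
  coeff_ne := by simp [sample_normal, sampleArc₁_E]
  left_ne := by simp [sampleArc₁_F, sampleArc₁_e]
  right_ne := by simp [sampleArc₂_F, sampleArc₂_e]
  triple_ne := by
    simp [sampleArc₁_e, sampleArc₂_e, sampleArc₁_q, sampleArc₂_q, cross_apply]
  linear_ne := by
    simp [sampleArc₂_F, sampleArc₂_e, sampleArc₂_q, sampleArc₂_G, sampleArc₁_D]
    norm_num
  discr_ne := by
    have key : ∀ {f : ℝ[X]} {m n : ℕ}, f.Separable → f.natDegree = m →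
        (derivative f).natDegree = n → resultant f (derivative f) m n ≠ 0 := by
      rintro f _ _ hf rfl rfl
      exact resultant_ne_zero _ _ hf
    exact key separable_formalU₂_sample natDegree_formalU₂_sample
      (by rw [natDegree_derivative, natDegree_formalU₂_sample])

/-! ### Analyticity in the data, and density of the generic set. -/

/-- A family of arcs that depends linearly on a parameter has analytic vectors. -/
theorem arcFamily_of_analytic {V : Type*} [NormedAddCommGroup V] [NormedSpace ℝ V]
    {A : Subring (V → ℝ)} (hA : ∀ g : V → ℝ, AnalyticOnNhd ℝ g Set.univ → g ∈ A)
    (L : V →L[ℝ] ArcData) : ArcFamily A L := by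
  have h : ∀ l : ArcData →L[ℝ] ℝ, AnalyticOnNhd ℝ (fun x => l (L x)) Set.univ := fun l =>
    (l.comp L).analyticOnNhd _
  have hra : AnalyticOnNhd ℝ (fun x => (L x).ra) Set.univ :=
    h ((ContinuousLinearMap.fst ℝ _ _).comp (ContinuousLinearMap.fst ℝ _ _))
  have hdec : AnalyticOnNhd ℝ (fun x => (L x).dec) Set.univ :=
    h ((ContinuousLinearMap.fst ℝ _ _).comp ((ContinuousLinearMap.snd ℝ _ _).comp
      (ContinuousLinearMap.fst ℝ _ _)))
  have hraDot : AnalyticOnNhd ℝ (fun x => (L x).raDot) Set.univ :=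
    h ((ContinuousLinearMap.fst ℝ _ _).comp ((ContinuousLinearMap.snd ℝ _ _).comp
      ((ContinuousLinearMap.snd ℝ _ _).comp (ContinuousLinearMap.fst ℝ _ _))))
  have hdecDot : AnalyticOnNhd ℝ (fun x => (L x).decDot) Set.univ :=
    h ((ContinuousLinearMap.snd ℝ _ _).comp ((ContinuousLinearMap.snd ℝ _ _).comp
      ((ContinuousLinearMap.snd ℝ _ _).comp (ContinuousLinearMap.fst ℝ _ _))))
  have hs : ∀ {f : V → ℝ}, AnalyticOnNhd ℝ f Set.univ →
      (fun x => Real.sin (f x)) ∈ A := fun hf => hA _ fun x hx =>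
    Real.analyticAt_sin.comp (hf x hx)
  have hc : ∀ {f : V → ℝ}, AnalyticOnNhd ℝ f Set.univ →
      (fun x => Real.cos (f x)) ∈ A := fun hf => hA _ fun x hx =>
    Real.analyticAt_cos.comp (hf x hx)
  have hneg : ∀ {f : V → ℝ}, f ∈ A → (fun x => -f x) ∈ A := fun hf => A.neg_mem hf
  refine ⟨fun i => hA _ ?_, fun i => hA _ ?_, fun i => ?_, ?_⟩
  · exact h ((ContinuousLinearMap.proj i).comp ((ContinuousLinearMap.fst ℝ _ _).comp
      (ContinuousLinearMap.snd ℝ _ _)))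
  · exact h ((ContinuousLinearMap.proj i).comp ((ContinuousLinearMap.snd ℝ _ _).comp
      (ContinuousLinearMap.snd ℝ _ _)))
  · fin_cases i
    · exact fun_mul_mem (hc hdec) (hc hra)
    · exact fun_mul_mem (hc hdec) (hs hra)
    · exact hs hdec
  · refine VecFamily.add (VecFamily.smul (fun_mul_mem (hA _ hraDot) (hc hdec)) fun i => ?_)
      (VecFamily.smul (hA _ hdecDot) fun i => ?_)
    · fin_cases i
      · exact hneg (hs hra)
      · exact hc hra
      · exact A.zero_mem
    · fin_cases i
      · exact hneg (fun_mul_mem (hs hdec) (hc hra))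
      · exact hneg (fun_mul_mem (hs hdec) (hs hra))
      · exact hc hdec

/-- The space of all data of two arcs. -/
abbrev PairData : Type := ArcData × ArcData

theorem arcFamily_fst {A : Subring (PairData → ℝ)}
    (hA : ∀ g : PairData → ℝ, AnalyticOnNhd ℝ g Set.univ → g ∈ A) :
    ArcFamily A (fun x => x.1) :=
  arcFamily_of_analytic hA (ContinuousLinearMap.fst ℝ ArcData ArcData)

theorem arcFamily_snd {A : Subring (PairData → ℝ)}
    (hA : ∀ g : PairData → ℝ, AnalyticOnNhd ℝ g Set.univ → g ∈ A) :
    ArcFamily A (fun x => x.2) :=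
  arcFamily_of_analytic hA (ContinuousLinearMap.snd ℝ ArcData ArcData)

/-- The analytic functions on the space of data. -/
def analyticFunctions : Subring (PairData → ℝ) where
  carrier := {g | AnalyticOnNhd ℝ g Set.univ}
  mul_mem' hf hg := hf.mul hg
  one_mem' := analyticOnNhd_const
  add_mem' hf hg := hf.add hg
  zero_mem' := analyticOnNhd_const
  neg_mem' hf := hf.neg

theorem analyticOnNhd_normSqD :
    AnalyticOnNhd ℝ (fun x : PairData => normSqD x.1 x.2) Set.univ := by
  have h₁ := arcFamily_fst (A := analyticFunctions) fun _ hg => hg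
  have h₂ := arcFamily_snd (A := analyticFunctions) fun _ hg => hg
  exact (h₁.D.cross h₂.D).dotProduct (h₁.D.cross h₂.D)

/-- The product of the expressions whose nonvanishing is required for generic data, apart
from `normSqD`. -/
def genericFactor (x : PairData) : ℝ :=
  (x.1.E ⬝ᵥ (x.1.D ⨯₃ x.2.D)) * (x.1.F ⬝ᵥ x.1.e) * (x.2.F ⬝ᵥ x.2.e) *
    ((x.1.e ⨯₃ x.2.e) ⬝ᵥ (x.1.q - x.2.q)) *
    ((x.2.F ⬝ᵥ x.2.e) * (x.2.q ⬝ᵥ x.1.D) - (x.2.G ⬝ᵥ x.2.e) * (x.2.e ⬝ᵥ x.1.D)) *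
    resultant (formalU₂ x.1 x.2) (derivative (formalU₂ x.1 x.2)) 10 9

theorem isGeneric_iff (a₁ a₂ : ArcData) :
    IsGeneric a₁ a₂ ↔ normSqD a₁ a₂ ≠ 0 ∧ genericFactor (a₁, a₂) ≠ 0 := by
  simp only [genericFactor, mul_ne_zero_iff]
  exact ⟨fun ⟨h₁, h₂, h₃, h₄, h₅, h₆, h₇⟩ => ⟨h₁, ⟨⟨⟨⟨h₂, h₃⟩, h₄⟩, h₅⟩, h₆⟩, h₇⟩,
    fun ⟨h₁, ⟨⟨⟨⟨h₂, h₃⟩, h₄⟩, h₅⟩, h₆⟩, h₇⟩ => ⟨h₁, h₂, h₃, h₄, h₅, h₆, h₇⟩⟩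

theorem genericFactor_mem :
    genericFactor ∈ regularFunctions (fun x : PairData => normSqD x.1 x.2)
      analyticOnNhd_normSqD := by
  have hA : ∀ g : PairData → ℝ, AnalyticOnNhd ℝ g Set.univ →
      g ∈ regularFunctions (fun x : PairData => normSqD x.1 x.2) analyticOnNhd_normSqD :=
    fun g hg => mem_regularFunctions _ hg
  have h₁ := arcFamily_fst hA
  have h₂ := arcFamily_snd hA
  have hU : (fun x : PairData => formalU₂ x.1 x.2) ∈ coeffFamilies
      (regularFunctions (fun x : PairData => normSqD x.1 x.2) analyticOnNhd_normSqD) :=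
    fun_resultant_mem (p₂_mem h₁ h₂ (inv_mem_regularFunctions _)
      fun _ => hA _ analyticOnNhd_const) (qBi_mem h₁ h₂) 5 2
  exact fun_mul_mem (fun_mul_mem (fun_mul_mem (fun_mul_mem (fun_mul_mem
    (h₁.E.dotProduct (h₁.D.cross h₂.D)) (h₁.F.dotProduct h₁.e)) (h₂.F.dotProduct h₂.e))
    ((h₁.e.cross h₂.e).dotProduct (h₁.q.sub h₂.q)))
    (fun_sub_mem (fun_mul_mem (h₂.F.dotProduct h₂.e) (h₂.q.dotProduct h₁.D))
      (fun_mul_mem (h₂.G.dotProduct h₂.e) (h₂.e.dotProduct h₁.D))))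
    (fun_resultant_mem hU (fun_derivative_mem hU) 10 9)

theorem isOpen_dense_isGeneric :
    IsOpen {x : PairData | IsGeneric x.1 x.2} ∧ Dense {x : PairData | IsGeneric x.1 x.2} := by
  obtain ⟨hn, hf⟩ := (isGeneric_iff _ _).1 isGeneric_sample
  have h := isOpen_dense_of_mem_regularFunctions analyticOnNhd_normSqD genericFactor_mem
    (w := (sampleArc₁, sampleArc₂)) hn hf
  simpa only [isGeneric_iff] using h

end

end KeplerLinkage

theorem mainTheorem3 :
    ∃ U : Set (KeplerLinkage.ArcData × KeplerLinkage.ArcData), IsOpen U ∧ Dense U ∧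
      ∀ a₁ a₂ : KeplerLinkage.ArcData, (a₁, a₂) ∈ U →
        (KeplerLinkage.u a₁ a₂).natDegree = 9 ∧
        KeplerLinkage.inRho₂ (KeplerLinkage.u a₁ a₂) ∈ KeplerLinkage.keplerIdeal a₁ a₂ ∧
        ∀ p : Polynomial ℝ, p ≠ 0 →
          KeplerLinkage.inRho₂ p ∈ KeplerLinkage.keplerIdeal a₁ a₂ →
          (KeplerLinkage.u a₁ a₂).natDegree ≤ p.natDegree :=
  ⟨{x | KeplerLinkage.IsGeneric x.1 x.2}, KeplerLinkage.isOpen_dense_isGeneric.1,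
    KeplerLinkage.isOpen_dense_isGeneric.2, fun _ _ h =>
      ⟨KeplerLinkage.IsGeneric.natDegree_u h, KeplerLinkage.IsGeneric.inRho₂_u_mem h,
        fun _ h0 hp => KeplerLinkage.IsGeneric.natDegree_u_le h h0 hp⟩⟩
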